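/- Let $k$ be a field and let $\mathcal B$ be a $k$-linear abelian category such that for all objects $X,Y$ the spaces $\operatorname{Hom}(X,Y)$ and $\operatorname{Ext}^m(X,Y)$, $m\ge 0$, are finite dimensional over $k$ and only finitely many of the $\operatorname{Ext}^m(X,Y)$ are non-zero. Assume that $\mathcal B$ has finite Krull dimension in the sense of Gabriel: with $\mathcal B_{-1}$ the subcategory of zero objects and $\mathcal B_m$ the Serre subcategory of all objects whose image in the quotient category $\mathcal B/\mathcal B_{m-1}$ has finite length, one has $\mathcal B=\mathcal B_m$ for some integer $m\ge -1$. Let $T_1,\dots,T_n$ ($n\ge 0$) be objects of $\mathcal B$ such that * $(T_1,\dots,T_n)$ is an exceptional collection: for every $i$ the ring $\operatorname{End}(T_i)$ is a division ring and $\operatorname{Ext}^m(T_i,T_i)=0$ for all $m>0$, and $\operatorname{Ext}^m(T_i,T_j)=0$ for all $m\ge 0$ whenever $i<j$; * every $T_i$ has projective dimension at most $1$, i.e. $\operatorname{Ext}^m(T_i,-)=0$ for all $m>1$; * $\operatorname{Ext}^1(T_i,T_j)=0$ for all $i,j$. Put $T=\bigoplus_{i=1}^n T_i$. If the rank of the Grothendieck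 group $K_0(\mathcal B)$ of $\mathcal B$ equals $n$, then $T$ is a tilting object in $\mathcal B$: in the bounded derived category $D^b(\mathcal B)$ one has $\operatorname{Hom}(T,T[i])=0$ for all integers $i\neq 0$, and the smallest full subcategory of $D^b(\mathcal B)$ that contains $\operatorname{add} T$ (the direct summands of finite direct sums of copies of $T$) and is closed under isomorphisms, shifts and cones is $D^b(\mathcal B)$ itself. -/

import Mathlib

open CategoryTheory CategoryTheory.Limits

universe w w' v u

attribute [local instance] Abelian.hasFiniteBiproducts

namespace TiltingTheory

section FiniteLength

variable {C : Type u} [Category.{v} C]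

/-- Objects of finite length: both chain conditions hold for subobjects. -/
def finiteLength (C : Type u) [Category.{v} C] : ObjectProperty C :=
  fun X => IsNoetherianObject X ∧ IsArtinianObject X

lemma le_iff_factors {X : C} (S S' : Subobject X) : S ≤ S' ↔ S'.Factors S.arrow := by
  constructor
  · intro h
    exact Subobject.factors_of_le _ h ((Subobject.factors_iff _ _).2 ⟨𝟙 _, Category.id_comp _⟩)
  · intro h
    exact Subobject.le_of_comm (S'.factorThru _ h) (S'.factorThru_arrow _ h)

lemma finiteLength_iff (X : C) :
    finiteLength C X ↔ WellFoundedGT (Subobject X) ∧ WellFoundedLT (Subobject X) := by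
  simp only [finiteLength, IsNoetherianObject, IsArtinianObject, ObjectProperty.is_iff]
  rfl

variable [Abelian C]

lemma factors_iff {X T : C} (S : Subobject X) (t : T ⟶ X) :
    S.Factors t ↔ t ≫ cokernel.π S.arrow = 0 := by
  constructor
  · intro h
    rw [← S.factorThru_arrow t h, Category.assoc, cokernel.condition, comp_zero]
  · intro h
    refine (Subobject.factors_iff _ _).2 ⟨Abelian.monoLift S.arrow t h, ?_⟩
    exact Abelian.monoLift_comp S.arrow t h

lemma factors_of_epi {X T T' : C} (S : Subobject X) (p : T' ⟶ T) [Epi p] (t : T ⟶ X)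
    (h : S.Factors (p ≫ t)) : S.Factors t := by
  rw [factors_iff] at h ⊢
  rw [← cancel_epi p, ← Category.assoc, h, comp_zero]

lemma factors_pullback_iff {X Y T : C} (f : X ⟶ Y) (S : Subobject Y) (t : T ⟶ X) :
    ((Subobject.pullback f).obj S).Factors t ↔ S.Factors (t ≫ f) := by
  have sq := Subobject.isPullback f S
  constructor
  · intro h
    rw [← Subobject.factorThru_arrow _ t h, Category.assoc, ← sq.w, ← Category.assoc]
    exact Subobject.factors_comp_arrow _
  · intro h
    rw [← sq.lift_snd (S.factorThru _ h) t (S.factorThru_arrow _ h)]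
    exact Subobject.factors_comp_arrow _

/-- Inverse images of subobjects along an epimorphism form a strictly increasing map. -/
lemma strictMono_pullback {X Y : C} (p : X ⟶ Y) [Epi p] :
    StrictMono (fun S : Subobject Y => (Subobject.pullback p).obj S) := by
  refine Monotone.strictMono_of_injective (Subobject.pullback p).monotone ?_
  have key : ∀ S S' : Subobject Y,
      (Subobject.pullback p).obj S ≤ (Subobject.pullback p).obj S' → S ≤ S' := by
    intro S S' h
    rw [le_iff_factors]
    refine factors_of_epi S' (pullback.fst S.arrow p) _ ?_
    rw [pullback.condition, ← factors_pullback_iff]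
    refine Subobject.factors_of_le _ h ?_
    rw [factors_pullback_iff, ← pullback.condition]
    exact Subobject.factors_comp_arrow _
  exact fun S S' h => le_antisymm (key S S' (le_of_eq h)) (key S' S (le_of_eq h.symm))

/-- For a short exact sequence `0 ⟶ X₁ ⟶ X₂ ⟶ X₃ ⟶ 0`, a subobject of `X₂` is strictly
increasingly encoded by its inverse image in `X₁` and its image in `X₃`. -/
lemma strictMono_pullback_image {S : ShortComplex C} (hS : S.ShortExact) :
    StrictMono (fun A : Subobject S.X₂ =>
      ((Subobject.pullback S.f).obj A, imageSubobject (A.arrow ≫ S.g))) := by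
  have hmono : Monotone (fun A : Subobject S.X₂ =>
      ((Subobject.pullback S.f).obj A, imageSubobject (A.arrow ≫ S.g))) := by
    intro A B h
    refine ⟨(Subobject.pullback S.f).monotone h, ?_⟩
    dsimp only
    rw [← Subobject.ofLE_arrow h, Category.assoc]
    exact imageSubobject_comp_le _ _
  intro A B hAB
  refine lt_of_le_of_ne (hmono hAB.le) fun heq => hAB.not_ge ?_
  obtain ⟨h₁, h₂⟩ := Prod.ext_iff.1 heq
  dsimp only at h₁ h₂
  have hfac : (imageSubobject (A.arrow ≫ S.g)).Factors (B.arrow ≫ S.g) := by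
    rw [h₂]
    exact (Subobject.factors_iff _ _).2
      ⟨factorThruImageSubobject (B.arrow ≫ S.g), imageSubobject_arrow_comp _⟩
  obtain ⟨T, p, hp, a, ha⟩ := surjective_up_to_refinements_of_epi
    (factorThruImageSubobject (A.arrow ≫ S.g)) ((imageSubobject _).factorThru _ hfac)
  have ha' : p ≫ B.arrow ≫ S.g = a ≫ A.arrow ≫ S.g := by
    have := congrArg (· ≫ (imageSubobject (A.arrow ≫ S.g)).arrow) ha
    simpa using this
  obtain ⟨T', q, hq, x, hx⟩ := hS.exact.exact_up_to_refinements
    (p ≫ B.arrow - a ≫ A.arrow) (by simp [Preadditive.sub_comp, ha'])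
  have hxB : B.Factors (x ≫ S.f) := by
    rw [← hx, ← Subobject.ofLE_arrow hAB.le, ← Category.assoc a, ← Preadditive.sub_comp,
      ← Category.assoc]
    exact Subobject.factors_comp_arrow _
  have hxA : A.Factors (x ≫ S.f) := by
    rw [← factors_pullback_iff] at hxB ⊢
    rwa [h₁]
  rw [le_iff_factors]
  refine factors_of_epi A p _ (factors_of_epi A q _ ?_)
  have : q ≫ p ≫ B.arrow = x ≫ S.f + (q ≫ a) ≫ A.arrow := by
    rw [← hx]; simp [Preadditive.comp_sub]
  rw [this]
  exact Subobject.factors_add _ _ hxA (Subobject.factors_comp_arrow _)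

/-- In an abelian category the objects of finite length form a Serre class. -/
instance isSerreClass_finiteLength : (finiteLength C).IsSerreClass where
  exists_zero := open ZeroObject in ⟨(0 : C), isZero_zero C, isNoetherianObject_of_isZero (isZero_zero C),
    isArtinianObject_of_isZero (isZero_zero C)⟩
  prop_of_mono f _ hY := by
    obtain ⟨_, _⟩ := hY
    exact ⟨isNoetherianObject_of_mono f, isArtinianObject_of_mono f⟩
  prop_of_epi f _ hX := by
    rw [finiteLength_iff] at hX ⊢
    obtain ⟨_, _⟩ := hX
    exact ⟨(strictMono_pullback f).wellFoundedGT, (strictMono_pullback f).wellFoundedLT⟩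
  prop_X₂_of_shortExact hS h₁ h₃ := by
    rw [finiteLength_iff] at h₁ h₃ ⊢
    obtain ⟨_, _⟩ := h₁
    obtain ⟨_, _⟩ := h₃
    exact ⟨(strictMono_pullback_image hS).wellFoundedGT,
      (strictMono_pullback_image hS).wellFoundedLT⟩

end FiniteLength

section KrullDimension

variable {C : Type u} [Category.{v} C] [Abelian C]

/-- For a Serre subcategory `P` of `C`: the objects of `C` whose image in the quotient category
`C / P` has finite length. -/
def finiteLengthModSerre (P : ObjectProperty C) [P.IsSerreClass] : ObjectProperty C :=
  (finiteLength P.isoModSerre.Localization).inverseImage P.isoModSerre.Q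

instance (P : ObjectProperty C) [P.IsSerreClass] : (finiteLengthModSerre P).IsSerreClass := by
  let : Abelian P.isoModSerre.Localization :=
    ObjectProperty.SerreClassLocalization.abelian P.isoModSerre.Q P
  have := ObjectProperty.SerreClassLocalization.preservesFiniteLimits P.isoModSerre.Q P
  have := ObjectProperty.SerreClassLocalization.preservesFiniteColimits P.isoModSerre.Q P
  exact inferInstanceAs ((finiteLength _).inverseImage P.isoModSerre.Q).IsSerreClass

/-- The Krull filtration (Gabriel) of an abelian category by Serre subcategories, with the index
shifted by one: the term of index `0` consists of the zero objects (it is usually written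
`C_{-1}`), and the term of index `n + 1` (usually written `C_n`) consists of the objects which
have finite length in the quotient of `C` by the term of index `n`. -/
def krullFiltrationAux (C : Type u) [Category.{v} C] [Abelian C] :
    ℕ → {P : ObjectProperty C // P.IsSerreClass}
  | 0 => ⟨IsZero, inferInstance⟩
  | n + 1 =>
    haveI := (krullFiltrationAux C n).2
    ⟨finiteLengthModSerre (krullFiltrationAux C n).1, inferInstance⟩

/-- The `n`-th term of the (shifted) Krull filtration, as a property of objects. -/
def krullFiltration (C : Type u) [Category.{v} C] [Abelian C] (n : ℕ) : ObjectProperty C :=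
  (krullFiltrationAux C n).1

/-- An abelian category has finite Krull dimension if its Krull filtration reaches the whole
category after finitely many steps. -/
def HasFiniteKrullDimension (C : Type u) [Category.{v} C] [Abelian C] : Prop :=
  ∃ n : ℕ, ∀ X : C, krullFiltration C n X

end KrullDimension

section GrothendieckGroup

/-- The relations `[X₂] = [X₁] + [X₃]` for all short exact sequences
`0 ⟶ X₁ ⟶ X₂ ⟶ X₃ ⟶ 0`. -/
def K₀Relations (C : Type u) [Category.{v} C] [Abelian C] : AddSubgroup (FreeAbelianGroup C) :=
  AddSubgroup.closure {x | ∃ S : ShortComplex C, S.ShortExact ∧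
    x = FreeAbelianGroup.of S.X₂ - FreeAbelianGroup.of S.X₁ - FreeAbelianGroup.of S.X₃}

/-- The Grothendieck group of an abelian category. -/
abbrev K₀ (C : Type u) [Category.{v} C] [Abelian C] : Type u :=
  FreeAbelianGroup C ⧸ K₀Relations C

end GrothendieckGroup

section Exceptional

variable {C : Type u} [Category.{v} C] [Abelian C] [HasExt.{w} C]

/-- All `Hom`- and `Ext`-spaces are finite dimensional over `k`, and for any two objects only
finitely many `Ext`-spaces between them are non-zero. -/
structure IsExtFinite (k : Type*) [Field k] (C : Type u) [Category.{v} C] [Abelian C]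
    [Linear k C] [HasExt.{w} C] : Prop where
  finite_hom (X Y : C) : Module.Finite k (X ⟶ Y)
  finite_ext (X Y : C) (m : ℕ) : Module.Finite k (Abelian.Ext.{w} X Y m)
  finite_degrees (X Y : C) : {m : ℕ | Nontrivial (Abelian.Ext.{w} X Y m)}.Finite

/-- `X` is exceptional: `Ext^m(X, X) = 0` for `m > 0` and `End X` is a division ring. -/
structure IsExceptional (X : C) : Prop where
  ext_self (m : ℕ) (hm : 0 < m) : Subsingleton (Abelian.Ext.{w} X X m)
  nontrivial_end : Nontrivial (End X)
  isUnit_of_ne_zero (f : End X) (hf : f ≠ 0) : IsUnit f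

/-- `T₁, …, Tₙ` is an exceptional collection: every `Tᵢ` is exceptional and
`Ext^m(Tᵢ, Tⱼ) = 0` for all `m ≥ 0` if `i < j`. -/
structure IsExceptionalCollection {n : ℕ} (T : Fin n → C) : Prop where
  isExceptional (i : Fin n) : IsExceptional.{w} (T i)
  ext_of_lt (i j : Fin n) (hij : i < j) (m : ℕ) : Subsingleton (Abelian.Ext.{w} (T i) (T j) m)

end Exceptional

section Tilting

open Pretriangulated

/-- `add T`: the direct summands of finite direct sums of copies of `T`. -/
def addClosure {A : Type*} [Category* A] [Preadditive A] [HasFiniteBiproducts A] (T : A) :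
    ObjectProperty A :=
  fun X => ∃ m : ℕ, Nonempty (Retract X (⨁ fun _ : Fin m => T))

/-- `T` is a tilting object of the triangulated category `A`: `Hom(T, T[i]) = 0` for all integers
`i ≠ 0`, and `A` is its only full subcategory that contains `add T` and is closed under shifts,
cones and isomorphisms. -/
structure IsTriangulatedTilting {A : Type*} [Category* A] [Preadditive A] [HasZeroObject A]
    [HasShift A ℤ] [∀ n : ℤ, (shiftFunctor A n).Additive] [Pretriangulated A]
    (T : A) : Prop where
  hom_shift_eq_zero (i : ℤ) (hi : i ≠ 0) (f : T ⟶ T⟦i⟧) : f = 0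
  generates (P : ObjectProperty A) (hP : P.IsTriangulated) (hiso : P.IsClosedUnderIsomorphisms)
    (hT : addClosure T ≤ P) (X : A) : P X

variable (C : Type u) [Category.{v} C] [Abelian C] [HasDerivedCategory.{w} C]

/-- The bounded derived category of `C`: the full triangulated subcategory of the derived category
on the objects with bounded cohomology. -/
abbrev BoundedDerivedCategory : Type (max u v) :=
  (DerivedCategory.TStructure.t (C := C)).bounded.FullSubcategory

variable {C}

/-- An object of `C`, as an object of the bounded derived category placed in degree `0`. -/
noncomputable def toBounded (X : C) : BoundedDerivedCategory C :=
  ⟨(DerivedCategory.singleFunctor C 0).obj X, ⟨0, inferInstance⟩, ⟨0, inferInstance⟩⟩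

/-- `T` is a tilting object of the abelian category `C`: it is one in the bounded derived
category of `C`. -/
def IsTiltingObject (T : C) : Prop :=
  IsTriangulatedTilting (toBounded.{w} T)

end Tilting

end TiltingTheory

/-! The vanishing half is immediate: `Ext¹` between the `Tᵢ` is zero by assumption and higher `Ext`
by projective dimension. Generation rests on two facts about the right perpendicular category `U`,
the objects `X` with `Hom(Tᵢ, X) = Ext¹(Tᵢ, X) = 0` for all `i`.

Reduction to `U`. Let `E` be one of the `Tᵢ`. A universal extension embeds any `X` into some `Y`
with `Ext¹(E, Y) = 0` and with cokernel an iterated self-extension of `E`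
(`exists_universal_extension`). A minimal right `add E`-approximation `P ⟶ Y` has kernel and
cokernel in `E^⊥` (`IsApprox.perp_kernel`, `IsApprox.perp_cokernel`). So `X` is built from copies of
`E` and objects of `E^⊥`. As `Tᵢ` is perpendicular to all `Tⱼ` with `j < i`, the collection can be
peeled off one member at a time, and every object is built from the `Tᵢ` and `U`. The same
construction extends each additive function on `U` to the whole category with value `0` on every
`Tᵢ` (`IsExceptionalCollection.exists_isAdditiveOn`).

`U = 0`. Otherwise finite Krull dimension supplies a nonzero additive function on `U`, namely length
modulo the last stage of the Krull filtration that does not contain `U`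
(`exists_isAdditiveOn_ne_zero`). Let it be nonzero at `Y` and extend it. The extension separates
`[Y]` from the span of the `[Tᵢ]`, and these are independent because their Euler form is triangular
with nonzero diagonal. Hence `K₀` would have rank at least `n + 1`
(`IsExceptionalCollection.isZero_of_perp`).

Consequently the `Tᵢ` generate all objects placed in degree zero, and truncation triangles give the
rest of the bounded derived category. -/

namespace TiltingTheory

/-! ### Length of objects: additivity and finiteness. -/

section Length

variable {C : Type u} [Category.{v} C] [Abelian C]

/-- The length of an object: the supremum of the lengths of chains of subobjects. -/
noncomputable def objLength (X : C) : ℕ∞ := Order.height (⊤ : Subobject X)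

omit [Abelian C] in
lemma height_le_objLength {X : C} (A : Subobject X) : Order.height A ≤ objLength X :=
  Order.height_mono le_top

/-- A subobject is strictly increasingly encoded by its trace on `X₁` and its image in `X₃`, and the
sum of the two heights is strictly increasing on pairs. Truncation to `ℕ` is harmless once both
lengths are finite. -/
lemma objLength_le_add {S : ShortComplex C} (hS : S.ShortExact) :
    objLength S.X₂ ≤ objLength S.X₁ + objLength S.X₃ := by
  by_cases h₁ : objLength S.X₁ = ⊤
  · simp [h₁]
  by_cases h₃ : objLength S.X₃ = ⊤
  · simp [h₃]
  have f₁ (A : Subobject S.X₁) : Order.height A ≠ ⊤ :=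
    ne_top_of_le_ne_top h₁ (height_le_objLength A)
  have f₃ (A : Subobject S.X₃) : Order.height A ≠ ⊤ :=
    ne_top_of_le_ne_top h₃ (height_le_objLength A)
  let φ : Subobject S.X₁ × Subobject S.X₃ → ℕ := fun p =>
    (Order.height p.1).toNat + (Order.height p.2).toNat
  have hφ : StrictMono φ := by
    have m₁ : Monotone fun A : Subobject S.X₁ => (Order.height A).toNat := fun A B h =>
      ENat.toNat_le_toNat (Order.height_mono h) (f₁ B)
    have m₃ : Monotone fun A : Subobject S.X₃ => (Order.height A).toNat := fun A B h =>
      ENat.toNat_le_toNat (Order.height_mono h) (f₃ B)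
    have s₁ : StrictMono fun A : Subobject S.X₁ => (Order.height A).toNat := fun A B h =>
      by
      have := Order.height_strictMono h (f₁ A).lt_top
      rwa [← ENat.natCast_toNat (f₁ A), ← ENat.natCast_toNat (f₁ B), Nat.cast_lt] at this
    have s₃ : StrictMono fun A : Subobject S.X₃ => (Order.height A).toNat := fun A B h =>
      by
      have := Order.height_strictMono h (f₃ A).lt_top
      rwa [← ENat.natCast_toNat (f₃ A), ← ENat.natCast_toNat (f₃ B), Nat.cast_lt] at this
    rintro ⟨a, b⟩ ⟨c, d⟩ h
    rcases Prod.lt_iff.1 h with ⟨h1, h2⟩ | ⟨h1, h2⟩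
    · exact add_lt_add_of_lt_of_le (s₁ h1) (m₃ h2)
    · exact add_lt_add_of_le_of_lt (m₁ h1) (s₃ h2)
  refine (Order.height_le_height_apply_of_strictMono _
    (hφ.comp (strictMono_pullback_image hS)) ⊤).trans ?_
  rw [Order.height_nat]
  simp only [Function.comp_apply, φ, Nat.cast_add, ENat.natCast_toNat (f₁ _), ENat.natCast_toNat (f₃ _)]
  exact add_le_add (height_le_objLength _) (height_le_objLength _)

/-- The image of a chain from `⊥` to `a` can be stacked on top of any chain ending at `h ⊥`. -/
lemma height_add_height_bot_le {α β : Type*} [PartialOrder α] [OrderBot α] [Preorder β] (h : α → β)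
    (hh : StrictMono h) (a : α) : Order.height a + Order.height (h ⊥) ≤ Order.height (h a) := by
  have key : ∀ (n : ℕ) (a : α), (n : ℕ∞) ≤ Order.height a →
      (n : ℕ∞) + Order.height (h ⊥) ≤ Order.height (h a) := by
    intro n
    induction n with
    | zero => intro a _; simpa using Order.height_mono (hh.monotone bot_le)
    | succ n ih =>
      intro a ha
      obtain ⟨p, hp, hn⟩ := Order.exists_series_of_le_height a ha
      -- The chain has length `n + 1` and ends at `a`, so its entry of index `n` is the penultimate
      -- one.
      have hlt : p ⟨n, by omega⟩ < a := by
        rw [← hp]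
        exact p.strictMono (by simp [Fin.lt_def, hn])
      have := ih (p ⟨n, by omega⟩) (Order.index_le_height p ⟨n, by omega⟩)
      calc ((n + 1 : ℕ) : ℕ∞) + Order.height (h ⊥) = (n + Order.height (h ⊥)) + 1 := by
            push_cast; ring
        _ ≤ Order.height (h (p ⟨n, by omega⟩)) + 1 := by gcongr
        _ ≤ _ := Order.height_add_one_le (hh hlt)
  by_cases ht : Order.height (h a) = ⊤
  · simp [ht]
  have hta : Order.height a ≠ ⊤ :=
    ne_top_of_le_ne_top ht (Order.height_le_height_apply_of_strictMono h hh a)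
  have := key (Order.height a).toNat a (by rw [ENat.natCast_toNat hta])
  rwa [ENat.natCast_toNat hta] at this

omit [Abelian C] in
lemma strictMono_map {X Y : C} (f : X ⟶ Y) [Mono f] :
    StrictMono (fun A : Subobject X => (Subobject.map f).obj A) :=
  (Subobject.map f).monotone.strictMono_of_injective (Subobject.map_obj_injective f)

lemma map_top_le_pullback {S : ShortComplex C} (A : Subobject S.X₃) [Mono S.f] :
    (Subobject.map S.f).obj ⊤ ≤ (Subobject.pullback S.g).obj A := by
  rw [Subobject.map_top, le_iff_factors, factors_pullback_iff]
  have : (Subobject.mk S.f).arrow ≫ S.g = 0 := by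
    rw [← Subobject.underlyingIso_hom_comp_eq_mk, Category.assoc, S.zero, comp_zero]
  rw [this]
  exact Subobject.factors_zero

/-- Preimages of a chain in `X₃` all contain `X₁`, so they continue a chain of subobjects of `X₁`.
-/
lemma add_objLength_le {S : ShortComplex C} (hS : S.ShortExact) :
    objLength S.X₁ + objLength S.X₃ ≤ objLength S.X₂ := by
  have := hS.mono_f
  have := hS.epi_g
  have h1 : objLength S.X₁ ≤ Order.height ((Subobject.map S.f).obj ⊤) :=
    Order.height_le_height_apply_of_strictMono _ (strictMono_map S.f) ⊤
  have h2 := Order.height_mono (map_top_le_pullback (S := S) ⊥)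
  have h3 := height_add_height_bot_le _ (strictMono_pullback S.g) (⊤ : Subobject S.X₃)
  calc objLength S.X₁ + objLength S.X₃ = objLength S.X₃ + objLength S.X₁ := add_comm _ _
    _ ≤ objLength S.X₃ + Order.height ((Subobject.pullback S.g).obj ⊥) := by
      gcongr; exact h1.trans h2
    _ ≤ _ := h3
    _ ≤ _ := height_le_objLength _

lemma objLength_eq_add {S : ShortComplex C} (hS : S.ShortExact) :
    objLength S.X₂ = objLength S.X₁ + objLength S.X₃ :=
  le_antisymm (objLength_le_add hS) (add_objLength_le hS)

lemma objLength_eq_zero_iff (X : C) : objLength X = 0 ↔ IsZero X := by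
  rw [objLength, Order.height_eq_zero, isMin_iff_eq_bot]
  constructor
  · intro h
    rw [IsZero.iff_id_eq_zero]
    have h1 : (⊤ : Subobject X).Factors (𝟙 X) := Subobject.top_factors _
    rw [h] at h1
    rwa [Subobject.bot_factors_iff_zero] at h1
  · intro h
    rw [eq_comm, ← top_le_iff, le_iff_factors]
    rw [h.eq_of_tgt (⊤ : Subobject X).arrow 0]
    exact Subobject.factors_zero

/-- The ascending condition gives a maximal subobject `A` of finite length. If `A ≠ ⊤`, the
descending condition gives a minimal `B > A`; then `B / A` has length at most one, so `B` has finite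
length as well, against maximality. -/
lemma objLength_ne_top {X : C} (hX : finiteLength C X) : objLength X ≠ ⊤ := by
  obtain ⟨_, _⟩ := (finiteLength_iff X).1 hX
  have hne : ({A : Subobject X | objLength (A : C) ≠ ⊤} : Set _).Nonempty := by
    refine ⟨⊥, ?_⟩
    have : objLength ((⊥ : Subobject X) : C) = 0 := by
      rw [objLength_eq_zero_iff]
      exact (isZero_zero C).of_iso Subobject.botCoeIsoZero
    simp [this]
  obtain ⟨A, hA, hmax⟩ := (wellFounded_gt (α := Subobject X)).has_min _ hne
  by_cases hAtop : A = ⊤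
  · subst hAtop
    have e : Nonempty (Subobject ((⊤ : Subobject X) : C) ≃o Subobject X) :=
      ⟨Subobject.mapIsoToOrderIso (asIso (⊤ : Subobject X).arrow)⟩
    obtain ⟨e⟩ := e
    have := Order.height_orderIso e ⊤
    rw [map_top] at this
    intro h
    exact hA (this.symm.trans h)
  obtain ⟨B, hB, hmin⟩ := (wellFounded_lt (α := Subobject X)).has_min {B | A < B}
    ⟨⊤, lt_top_iff_ne_top.2 hAtop⟩
  exfalso
  refine hmax B ?_ hB
  let S : ShortComplex C := ShortComplex.mk (Subobject.ofLE A B hB.le)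
    (cokernel.π (Subobject.ofLE A B hB.le)) (cokernel.condition _)
  have hS : S.ShortExact := { exact := ShortComplex.exact_cokernel _ }
  have h1 : objLength S.X₃ ≤ 1 := by
    -- A chain `z < y < ⊤` in `B / A` pulls back to a subobject `φ y` strictly between `A` and `B`.
    by_contra! h
    obtain ⟨y, z, hzy, hy⟩ := Order.one_lt_height_iff.1 h
    let φ : Subobject S.X₃ → Subobject X := fun c =>
      (Subobject.map B.arrow).obj ((Subobject.pullback S.g).obj c)
    have hφ : StrictMono φ := (strictMono_map B.arrow).comp (strictMono_pullback S.g)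
    have hAz : A ≤ φ z := by
      have : A = (Subobject.map B.arrow).obj ((Subobject.map S.f).obj ⊤) := by
        rw [Subobject.map_top, Subobject.map_mk]
        simp [S]
      rw [this]
      exact (Subobject.map B.arrow).monotone (map_top_le_pullback z)
    refine hmin (φ y) (hAz.trans_lt (hφ hzy)) ((hφ hy).trans_le ?_)
    have : B = (Subobject.map B.arrow).obj ⊤ := by simp [Subobject.map_top]
    conv_rhs => rw [this]
    exact (Subobject.map B.arrow).monotone le_top
  have h2 := objLength_le_add hS
  refine ne_top_of_le_ne_top ?_ h2
  exact fun h => (ENat.add_eq_top.1 h).elim hA (ne_top_of_le_ne_top ENat.one_ne_top h1)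

end Length

/-! ### Wide subcategories and additive functions on them. -/

section AdditiveFunctions

variable {C : Type u} [Category.{v} C] [Abelian C]

/-- `f` is additive on the short exact sequences whose terms satisfy `A`. -/
def IsAdditiveOn (A : ObjectProperty C) (f : C → ℤ) : Prop :=
  ∀ ⦃S : ShortComplex C⦄, S.ShortExact → A S.X₁ → A S.X₂ → A S.X₃ → f S.X₂ = f S.X₁ + f S.X₃

/-- Wide subcategories: closed under kernels, cokernels and extensions. -/
structure IsWide (A : ObjectProperty C) : Prop where
  zero {X : C} (hX : IsZero X) : A X
  prop_X₁ {S : ShortComplex C} (hS : S.ShortExact) (h₂ : A S.X₂) (h₃ : A S.X₃) : A S.X₁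
  prop_X₂ {S : ShortComplex C} (hS : S.ShortExact) (h₁ : A S.X₁) (h₃ : A S.X₃) : A S.X₂
  prop_X₃ {S : ShortComplex C} (hS : S.ShortExact) (h₁ : A S.X₁) (h₂ : A S.X₂) : A S.X₃
  image {X Y : C} (f : X ⟶ Y) (hX : A X) (hY : A Y) : A (image f)

lemma shortExact_kernel_image {X Y : C} (f : X ⟶ Y) :
    (ShortComplex.mk (kernel.ι f) (factorThruImage f)
      (by rw [← cancel_mono (image.ι f)]; simp)).ShortExact where
  exact := by
    apply ShortComplex.exact_of_f_is_kernel
    refine KernelFork.IsLimit.ofι _ _ (fun g hg => kernel.lift f g ?_) ?_ ?_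
    · dsimp at hg
      rw [← image.fac f, ← Category.assoc, hg, zero_comp]
    · intro T g hg
      simp
    · intro T g hg m hm
      rw [← cancel_mono (kernel.ι f)]
      simpa using hm

lemma shortExact_image_cokernel {X Y : C} (f : X ⟶ Y) :
    (ShortComplex.mk (image.ι f) (cokernel.π f)
      (by rw [← cancel_epi (factorThruImage f)]; simp)).ShortExact where
  exact := by
    apply ShortComplex.exact_of_g_is_cokernel
    refine CokernelCofork.IsColimit.ofπ _ _ (fun g hg => cokernel.desc f g ?_) ?_ ?_
    · dsimp at hg
      rw [← image.fac f, Category.assoc, hg, comp_zero]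
    · intro T g hg
      simp
    · intro T g hg m hm
      rw [← cancel_epi (cokernel.π f)]
      simpa using hm

open ZeroObject in
-- This degenerate sequence is the source of isomorphism invariance for wide subcategories and
-- additive functions.
lemma shortExact_of_isIso {X Y : C} (f : X ⟶ Y) [IsIso f] :
    (ShortComplex.mk f (0 : Y ⟶ (0 : C)) comp_zero).ShortExact where
  exact := (ShortComplex.exact_iff_epi _ rfl).2 (inferInstanceAs (Epi f))
  epi_g := ⟨fun _ _ _ => (isZero_zero C).eq_of_src _ _⟩

attribute [local simp] pushout.inl_desc pushout.inr_desc pushout.inl_desc_assoc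
  pushout.inr_desc_assoc

/-- The Noether isomorphism theorem for `X ⊆ Y ⊆ Y'`. -/
lemma exists_shortExact_shortExact {S : ShortComplex C} (hS : S.ShortExact) {Y' W : C}
    {i : S.X₂ ⟶ Y'} {p : Y' ⟶ W} {w : i ≫ p = 0} (h : (ShortComplex.mk i p w).ShortExact) :
    ∃ (R : C) (a : Y' ⟶ R) (b : S.X₃ ⟶ R) (c : R ⟶ W) (wa : (S.f ≫ i) ≫ a = 0) (wb : b ≫ c = 0),
      (ShortComplex.mk (S.f ≫ i) a wa).ShortExact ∧ (ShortComplex.mk b c wb).ShortExact := by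
  have : Mono i := h.mono_f
  have : Epi p := h.epi_g
  have := hS.mono_f
  have := hS.epi_g
  have wa : (S.f ≫ i) ≫ pushout.inl i S.g = 0 := by
    rw [Category.assoc, pushout.condition, S.zero_assoc, zero_comp]
  have wb : pushout.inr i S.g ≫ pushout.desc p 0 (by rw [w, comp_zero]) = 0 := by simp
  refine ⟨pushout i S.g, pushout.inl _ _, pushout.inr _ _, pushout.desc p 0 (by rw [w, comp_zero]),
    wa, wb, ?_, ?_⟩
  · refine { exact := ShortComplex.exact_of_g_is_cokernel _ ?_, mono_f := mono_comp _ _ }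
    refine CokernelCofork.IsColimit.ofπ _ _ (fun g hg => pushout.desc g
      (hS.exact.desc (i ≫ g) (by simpa using hg)) (by simp)) ?_ ?_
    · intro T g hg
      simp
    · intro T g hg m hm
      rw [← cancel_epi (pushout.inl i S.g)]
      simpa using hm
  · have : Epi (pushout.desc p 0 (by rw [w, comp_zero]) : pushout i S.g ⟶ W) := by
      have : Epi (pushout.inl i S.g ≫ pushout.desc p 0 (by rw [w, comp_zero])) := by simpa
      exact epi_of_epi (pushout.inl i S.g) _
    refine { exact := ShortComplex.exact_of_g_is_cokernel _ ?_ }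
    refine CokernelCofork.IsColimit.ofπ _ _ (fun g hg => h.exact.desc (pushout.inl _ _ ≫ g) ?_)
      ?_ ?_
    · dsimp at hg ⊢
      rw [pushout.condition_assoc, hg, comp_zero]
    · intro T g hg
      dsimp at hg ⊢
      apply pushout.hom_ext
      · simpa using h.exact.g_desc (pushout.inl _ _ ≫ g) (by
        dsimp at hg ⊢
        rw [pushout.condition_assoc, hg, comp_zero])
      · simp [hg]
    · intro T g hg m hm
      rw [← cancel_epi p]
      dsimp at hm ⊢
      rw [h.exact.g_desc, ← hm, pushout.inl_desc_assoc]

/-- Pushing out along `i` does not change the cokernel of `j`. This serves to compare two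
coresolutions of one object. -/
lemma shortExact_pushout {X Y Z W : C} {i : X ⟶ Y} {j : X ⟶ Z} {p : Z ⟶ W} {w : j ≫ p = 0}
    (h : (ShortComplex.mk j p w).ShortExact) [Mono i] :
    (ShortComplex.mk (pushout.inl i j) (pushout.desc 0 p (by rw [w, comp_zero])) (by simp) :
      ShortComplex C).ShortExact := by
  have : Mono j := h.mono_f
  have : Epi p := h.epi_g
  have : Epi (pushout.desc 0 p (by rw [w, comp_zero]) : pushout i j ⟶ W) := by
    have : Epi (pushout.inr i j ≫ pushout.desc 0 p (by rw [w, comp_zero])) := by simpa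
    exact epi_of_epi (pushout.inr i j) _
  refine { exact := ShortComplex.exact_of_g_is_cokernel _ ?_ }
  refine CokernelCofork.IsColimit.ofπ _ _ (fun g hg => h.exact.desc (pushout.inr _ _ ≫ g) ?_)
    ?_ ?_
  · dsimp at hg ⊢
    rw [← pushout.condition_assoc, hg, comp_zero]
  · intro T g hg
    dsimp at hg ⊢
    apply pushout.hom_ext
    · simp [hg]
    · simpa using h.exact.g_desc (pushout.inr _ _ ≫ g) (by
      dsimp at hg ⊢
      rw [← pushout.condition_assoc, hg, comp_zero])
  · intro T g hg m hm
    rw [← cancel_epi p]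
    dsimp at hm ⊢
    rw [h.exact.g_desc, ← hm, pushout.inr_desc_assoc]

namespace IsWide

variable {A : ObjectProperty C} (hA : IsWide A)
include hA

lemma of_iso {X Y : C} (e : X ≅ Y) (hX : A X) : A Y :=
  hA.prop_X₁ (shortExact_of_isIso e.inv) hX (hA.zero (isZero_zero C))

lemma biprod {X Y : C} (hX : A X) (hY : A Y) : A (X ⊞ Y) :=
  hA.prop_X₂ (ShortComplex.Splitting.ofHasBinaryBiproduct X Y).shortExact hX hY

lemma kernel {X Y : C} (f : X ⟶ Y) (hX : A X) (hY : A Y) : A (kernel f) :=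
  hA.prop_X₁ (shortExact_kernel_image f) hX (hA.image f hX hY)

lemma cokernel {X Y : C} (f : X ⟶ Y) (hX : A X) (hY : A Y) : A (cokernel f) :=
  hA.prop_X₃ (shortExact_image_cokernel f) (hA.image f hX hY) hY

end IsWide

lemma isWide_iInf {ι : Sort*} {A : ι → ObjectProperty C} (hA : ∀ i, IsWide (A i)) :
    IsWide (fun X => ∀ i, A i X) where
  zero hX i := (hA i).zero hX
  prop_X₁ hS h₂ h₃ i := (hA i).prop_X₁ hS (h₂ i) (h₃ i)
  prop_X₂ hS h₁ h₃ i := (hA i).prop_X₂ hS (h₁ i) (h₃ i)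
  prop_X₃ hS h₁ h₂ i := (hA i).prop_X₃ hS (h₁ i) (h₂ i)
  image f hX hY i := (hA i).image f (hX i) (hY i)

lemma IsWide.inf {A A' : ObjectProperty C} (hA : IsWide A) (hA' : IsWide A') :
    IsWide (fun X => A X ∧ A' X) where
  zero hX := ⟨hA.zero hX, hA'.zero hX⟩
  prop_X₁ hS h₂ h₃ := ⟨hA.prop_X₁ hS h₂.1 h₃.1, hA'.prop_X₁ hS h₂.2 h₃.2⟩
  prop_X₂ hS h₁ h₃ := ⟨hA.prop_X₂ hS h₁.1 h₃.1, hA'.prop_X₂ hS h₁.2 h₃.2⟩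
  prop_X₃ hS h₁ h₂ := ⟨hA.prop_X₃ hS h₁.1 h₂.1, hA'.prop_X₃ hS h₁.2 h₂.2⟩
  image f hX hY := ⟨hA.image f hX.1 hY.1, hA'.image f hX.2 hY.2⟩

namespace IsAdditiveOn

variable {A : ObjectProperty C} {f : C → ℤ} (hf : IsAdditiveOn A f) (hA : IsWide A)
include hf hA

open ZeroObject in
lemma map_zero : f (0 : C) = 0 := by
  have h0 := hA.zero (isZero_zero C)
  have : f (0 : C) = f (0 : C) + f (0 : C) :=
    hf (shortExact_of_isIso (𝟙 (0 : C))) h0 h0 h0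
  omega

lemma congr_of_iso {X Y : C} (e : X ≅ Y) (hX : A X) : f X = f Y := by
  have : f Y = f X + f _ := hf (shortExact_of_isIso e.hom) hX (hA.of_iso e hX)
    (hA.zero (isZero_zero C))
  rw [hf.map_zero hA] at this
  omega

lemma map_isZero {X : C} (hX : IsZero X) : f X = 0 := by
  rw [hf.congr_of_iso hA hX.isoZero (hA.zero hX), hf.map_zero hA]

lemma map_exact {S : ShortComplex C} (hS : S.Exact) (h₁ : A S.X₁) (h₂ : A S.X₂) (h₃ : A S.X₃) :
    f S.X₂ = f (image S.f) + f (image S.g) := by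
  have e : image S.f ≅ kernel S.g := (imageSubobjectIso S.f).symm ≪≫
    Subobject.isoOfEq _ _ ((ShortComplex.exact_iff_image_eq_kernel S).1 hS) ≪≫
      kernelSubobjectIso S.g
  rw [hf.congr_of_iso hA e (hA.image _ h₁ h₂)]
  exact hf (shortExact_kernel_image S.g) (hA.kernel _ h₂ h₃) h₂ (hA.image _ h₂ h₃)

lemma map_image_of_mono {X Y : C} (g : X ⟶ Y) [Mono g] (hX : A X) : f (image g) = f X :=
  (hf.congr_of_iso hA (imageMonoIsoSource g).symm hX).symm

lemma map_image_of_epi {X Y : C} (g : X ⟶ Y) [Epi g] (hX : A X) (hY : A Y) :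
    f (image g) = f Y :=
  have : Epi (image.ι g) := epi_of_epi_fac (image.fac g)
  have : IsIso (image.ι g) := isIso_of_mono_of_epi _
  hf.congr_of_iso hA (asIso (image.ι g)) (hA.image g hX hY)

end IsAdditiveOn

/-- Additive functions extend along coresolutions of length one by objects of a class which is
closed under extensions and quotients. -/
lemma exists_isAdditiveOn_of_coresolution {A V : ObjectProperty C} (hA : IsWide A) (hVA : V ≤ A)
    (hV₂ : ∀ ⦃S : ShortComplex C⦄, S.ShortExact → V S.X₁ → V S.X₃ → V S.X₂)
    (hV₃ : ∀ ⦃S : ShortComplex C⦄, S.ShortExact → V S.X₂ → A S.X₃ → V S.X₃)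
    (hV₀ : ∀ ⦃X : C⦄, IsZero X → V X)
    (hres : ∀ X, A X → ∃ (Y W : C) (i : X ⟶ Y) (p : Y ⟶ W) (w : i ≫ p = 0),
      (ShortComplex.mk i p w).ShortExact ∧ V Y ∧ A W)
    {f : C → ℤ} (hf : IsAdditiveOn V f) :
    ∃ g : C → ℤ, IsAdditiveOn A g ∧ ∀ X, V X → g X = f X := by
  classical
  choose Y W i p w hS hY hW using hres
  have uniq {X Y W Y' W' : C} {i : X ⟶ Y} {p : Y ⟶ W} {w : i ≫ p = 0} {i' : X ⟶ Y'}
      {p' : Y' ⟶ W'} {w' : i' ≫ p' = 0} (h : (ShortComplex.mk i p w).ShortExact)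
      (h' : (ShortComplex.mk i' p' w').ShortExact) (hY : V Y) (hW : A W) (hY' : V Y')
      (hW' : A W') : f Y - f W = f Y' - f W' := by
    have : Mono i := h.mono_f
    have : Mono i' := h'.mono_f
    have hW : V W := hV₃ h hY hW
    have hW' : V W' := hV₃ h' hY' hW'
    -- The pushout of `Y` and `Y'` over `X` is an extension of `W'` by `Y` and of `W` by `Y'`;
    -- evaluating `f` on it both ways gives `f Y + f W' = f Y' + f W`.
    have h1 := shortExact_pushout (i := i) h'
    have h2 := shortExact_pushout (i := i') h
    have e : pushout i i' ≅ pushout i' i := pushoutSymmetry i i'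
    have hQ : V (pushout i i') := hV₂ h1 hY hW'
    have hQ' : V (pushout i' i) := hV₂ h2 hY' hW
    have e1 : f (pushout i i') = f Y + f W' := hf h1 hY hQ hW'
    have e2 : f (pushout i' i) = f Y' + f W := hf h2 hY' hQ' hW
    have hz := hV₀ (isZero_zero C)
    have e3 := hf (shortExact_of_isIso e.hom) hQ hQ' hz
    have e4 := hf (shortExact_of_isIso (𝟙 _)) hz hz hz
    dsimp at e3 e4
    omega
  let g : C → ℤ := fun X => if h : A X then f (Y X h) - f (W X h) else 0
  have hg {X Y W : C} {i : X ⟶ Y} {p : Y ⟶ W} {w : i ≫ p = 0} (hX : A X)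
      (h : (ShortComplex.mk i p w).ShortExact) (hY' : V Y) (hW' : A W) : g X = f Y - f W := by
    simp only [g, dif_pos hX]
    exact uniq (hS X hX) h (hY X hX) (hW X hX) hY' hW'
  refine ⟨g, ?_, ?_⟩
  · intro S hSe h₁ h₂ h₃
    -- One coresolution `X₂ ⟶ Y ⟶ W` induces `X₁ ⟶ Y ⟶ R` and `X₃ ⟶ R ⟶ W` with `R = Y / X₁`, and
    -- the two contributions of `R` cancel.
    obtain ⟨R, a, b, c, wa, wb, ha, hb⟩ := exists_shortExact_shortExact hSe (hS S.X₂ h₂)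
    have hRA : A R := hA.prop_X₃ ha h₁ (hVA _ (hY _ h₂))
    have hR : V R := hV₃ ha (hY _ h₂) hRA
    rw [hg h₁ ha (hY _ h₂) hRA, hg h₂ (hS _ h₂) (hY _ h₂) (hW _ h₂), hg h₃ hb hR (hW _ h₂)]
    ring
  · intro X hX
    have hz := hV₀ (isZero_zero C)
    have e4 := hf (shortExact_of_isIso (𝟙 _)) hz hz hz
    rw [hg (hVA _ hX) (shortExact_of_isIso (𝟙 X)) hX (hA.zero (isZero_zero C))]
    dsimp at e4
    omega

end AdditiveFunctions

/-! ### Perpendicular categories and minimal approximations. -/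

section Perpendicular

open Abelian

variable {C : Type u} [Category.{v} C] [Abelian C] [HasExt.{w} C]

/-- The objects `X` with `Ext¹(E, X) = 0`. -/
def extOneVanish (E : C) : ObjectProperty C := fun X => Subsingleton (Ext.{w} E X 1)

/-- The right perpendicular category of `E`. -/
def perp (E : C) : ObjectProperty C := fun X => (∀ f : E ⟶ X, f = 0) ∧ extOneVanish.{w} E X

variable {E : C}

lemma extOneVanish_of_isZero {X : C} (hX : IsZero X) : extOneVanish.{w} E X := by
  refine ⟨fun a b => ?_⟩
  rw [← a.comp_mk₀_id, ← b.comp_mk₀_id, hX.eq_of_src (𝟙 X) 0]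
  simp

lemma exists_lift_of_extOneVanish {S : ShortComplex C} (hS : S.ShortExact)
    (h : extOneVanish.{w} E S.X₁) (g : E ⟶ S.X₃) : ∃ g' : E ⟶ S.X₂, g' ≫ S.g = g := by
  have : Subsingleton (Ext.{w} E S.X₁ 1) := h
  obtain ⟨x, hx⟩ := Ext.covariant_sequence_exact₃ E hS (Ext.mk₀ g) (zero_add 1)
    (Subsingleton.elim _ _)
  obtain ⟨y, rfl⟩ := (Ext.mk₀_bijective _ _).2 x
  refine ⟨y, (Ext.mk₀_bijective _ _).1 ?_⟩
  rw [← hx, Ext.mk₀_comp_mk₀]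

lemma extOneVanish_X₁ {S : ShortComplex C} (hS : S.ShortExact) (h₂ : extOneVanish.{w} E S.X₂)
    (h : ∀ g : E ⟶ S.X₃, ∃ g' : E ⟶ S.X₂, g' ≫ S.g = g) : extOneVanish.{w} E S.X₁ := by
  have : Subsingleton (Ext.{w} E S.X₂ 1) := h₂
  refine subsingleton_of_forall_eq 0 fun x => ?_
  obtain ⟨y, rfl⟩ := Ext.covariant_sequence_exact₁ E hS x (Subsingleton.elim _ _) (zero_add 1)
  obtain ⟨g, rfl⟩ := (Ext.mk₀_bijective _ _).2 y
  obtain ⟨g', rfl⟩ := h g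
  rw [← Ext.mk₀_comp_mk₀, Ext.comp_assoc_of_second_deg_zero, hS.comp_extClass, Ext.comp_zero]

lemma extOneVanish_X₂ {S : ShortComplex C} (hS : S.ShortExact) (h₁ : extOneVanish.{w} E S.X₁)
    (h₃ : extOneVanish.{w} E S.X₃) : extOneVanish.{w} E S.X₂ := by
  have : Subsingleton (Ext.{w} E S.X₁ 1) := h₁
  have : Subsingleton (Ext.{w} E S.X₃ 1) := h₃
  refine subsingleton_of_forall_eq 0 fun x => ?_
  obtain ⟨y, rfl⟩ := Ext.covariant_sequence_exact₂ E hS x (Subsingleton.elim _ _)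
  rw [Subsingleton.elim y 0, Ext.zero_comp]

/-- The obstruction lies in `Ext²(E, X₁)`, which is zero. Hence vanishing of `Ext¹(E, -)` passes to
quotients. -/
lemma exists_ext_lift [HasProjectiveDimensionLE E 1] {S : ShortComplex C} (hS : S.ShortExact)
    (x : Ext.{w} E S.X₃ 1) : ∃ y : Ext.{w} E S.X₂ 1, y.comp (Ext.mk₀ S.g) (add_zero 1) = x :=
  Ext.covariant_sequence_exact₃ E hS x (n₁ := 2) rfl
    (Ext.eq_zero_of_hasProjectiveDimensionLT _ 2 le_rfl)

lemma extOneVanish_X₃ [HasProjectiveDimensionLE E 1] {S : ShortComplex C} (hS : S.ShortExact)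
    (h₂ : extOneVanish.{w} E S.X₂) : extOneVanish.{w} E S.X₃ := by
  have : Subsingleton (Ext.{w} E S.X₂ 1) := h₂
  refine subsingleton_of_forall_eq 0 fun x => ?_
  obtain ⟨y, rfl⟩ := exists_ext_lift hS x
  rw [Subsingleton.elim y 0, Ext.zero_comp]

lemma isWide_perp (E : C) [HasProjectiveDimensionLE E 1] : IsWide (perp.{w} E) where
  zero hX := ⟨fun f => hX.eq_of_tgt _ _, extOneVanish_of_isZero hX⟩
  prop_X₁ {S} hS h₂ h₃ := by
    have := hS.mono_f
    refine ⟨fun f => ?_, extOneVanish_X₁ hS h₂.2 fun g => ⟨0, ?_⟩⟩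
    · rw [← cancel_mono S.f, h₂.1 (f ≫ S.f), zero_comp]
    · rw [h₃.1 g, zero_comp]
  prop_X₂ {S} hS h₁ h₃ := by
    have := hS.mono_f
    refine ⟨fun f => ?_, extOneVanish_X₂ hS h₁.2 h₃.2⟩
    have h := hS.exact.lift_f f (h₃.1 _)
    rw [← h, h₁.1 (hS.exact.lift f _), zero_comp]
  prop_X₃ {S} hS h₁ h₂ := by
    refine ⟨fun f => ?_, extOneVanish_X₃ hS h₂.2⟩
    obtain ⟨g, rfl⟩ := exists_lift_of_extOneVanish hS h₁.2 f
    rw [h₂.1 g, zero_comp]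
  image f hX hY := by
    -- The image inherits `Hom`-vanishing as a subobject of `Y` and `Ext¹`-vanishing as a quotient
    -- of `X`.
    refine ⟨fun g => ?_, extOneVanish_X₃ (shortExact_kernel_image f) hX.2⟩
    rw [← cancel_mono (Limits.image.ι f), hY.1 (g ≫ Limits.image.ι f), zero_comp]

/-- Finite direct sums of copies of `E`. -/
inductive IsFiniteSum (E : C) : C → Prop
  | zero {X : C} (hX : IsZero X) : IsFiniteSum E X
  | self : IsFiniteSum E E
  | biprod {X Y : C} (hX : IsFiniteSum E X) (hY : IsFiniteSum E Y) : IsFiniteSum E (X ⊞ Y)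

namespace IsFiniteSum

omit [HasExt.{w} C] in
lemma prop {A : ObjectProperty C} (hA : IsWide A) (hE : A E) {P : C} (hP : IsFiniteSum E P) :
    A P := by
  induction hP with
  | zero hX => exact hA.zero hX
  | self => exact hE
  | biprod _ _ h h' => exact hA.biprod h h'

lemma extOneVanish (hE : extOneVanish.{w} E E) {P : C} (hP : IsFiniteSum E P) :
    extOneVanish.{w} E P := by
  induction hP with
  | zero hX => exact extOneVanish_of_isZero hX
  | self => exact hE
  | biprod _ _ h h' =>
    exact extOneVanish_X₂ (ShortComplex.Splitting.ofHasBinaryBiproduct _ _).shortExact h h'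

omit [HasExt.{w} C] in
lemma exists_lift {X Y : C} {p : X ⟶ Y} (h : ∀ g : E ⟶ Y, ∃ g' : E ⟶ X, g' ≫ p = g) {P : C}
    (hP : IsFiniteSum E P) (g : P ⟶ Y) : ∃ g' : P ⟶ X, g' ≫ p = g := by
  induction hP with
  | zero hX => exact ⟨0, hX.eq_of_src _ _⟩
  | self => exact h g
  | biprod _ _ h h' =>
    obtain ⟨a, ha⟩ := h (biprod.inl ≫ g)
    obtain ⟨b, hb⟩ := h' (biprod.inr ≫ g)
    exact ⟨biprod.desc a b, by ext <;> simp [ha, hb]⟩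

omit [HasExt.{w} C] in
lemma comp_injective {X Y : C} {p : X ⟶ Y} (h : ∀ g : E ⟶ X, g ≫ p = 0 → g = 0) {P : C}
    (hP : IsFiniteSum E P) (g : P ⟶ X) (hg : g ≫ p = 0) : g = 0 := by
  induction hP with
  | zero hX => exact hX.eq_of_src _ _
  | self => exact h g hg
  | biprod _ _ h h' =>
    ext
    · simpa using h (biprod.inl ≫ g) (by simp [hg])
    · simpa using h' (biprod.inr ≫ g) (by simp [hg])

end IsFiniteSum

omit [HasExt.{w} C] in
/-- `p : P ⟶ X` is a minimal right `add E`-approximation. -/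
structure IsApprox (E : C) {P X : C} (p : P ⟶ X) : Prop where
  isFiniteSum : IsFiniteSum E P
  eq_zero (g : E ⟶ P) (hg : g ≫ p = 0) : g = 0
  exists_lift (g : E ⟶ X) : ∃ g' : E ⟶ P, g' ≫ p = g

section Existence

variable {k : Type*} [Field k] [Linear k C]

-- Copies of `E` are adjoined to `P` along maps `E ⟶ X` that do not yet factor. Since `End E` is a
-- division ring, `Hom(E, P) ⟶ Hom(E, X)` stays injective, so the growth of `dim Hom(E, P)` is
-- bounded and the process stops.
omit [HasExt.{w} C] in
lemma exists_isApprox (hfin : ∀ X : C, Module.Finite k (E ⟶ X)) (hne : Nontrivial (End E))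
    (hdiv : ∀ f : End E, f ≠ 0 → IsUnit f) (X : C) :
    ∃ (P : C) (p : P ⟶ X), IsApprox E p := by
  have finrank_le {P X : C} (p : P ⟶ X) (h : ∀ g : E ⟶ P, g ≫ p = 0 → g = 0) :
      Module.finrank k (E ⟶ P) ≤ Module.finrank k (E ⟶ X) := by
    refine LinearMap.finrank_le_finrank_of_injective (f := Linear.rightComp k E p) ?_
    exact (injective_iff_map_eq_zero _).2 h
  have step {P : C} (p : P ⟶ X) (h : ∀ g : E ⟶ P, g ≫ p = 0 → g = 0) (f : E ⟶ X)
      (hf : ¬ ∃ g' : E ⟶ P, g' ≫ p = f) (g : E ⟶ P ⊞ E) (hg : g ≫ biprod.desc p f = 0) : g = 0 := by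
    have hg' : (g ≫ biprod.fst) ≫ p + (g ≫ biprod.snd) ≫ f = 0 := by
      rw [← hg, biprod.desc_eq]; simp
    -- A nonzero component in the new copy of `E` would be invertible, and `f` would then factor
    -- through `p`.
    have h2 : g ≫ biprod.snd = 0 := by
      by_contra hne
      obtain ⟨u, hu⟩ := hdiv (g ≫ biprod.snd) hne
      apply hf
      have e : (u⁻¹ : (End E)ˣ).1 ≫ (g ≫ biprod.snd) = 𝟙 E := by
        have := u.mul_inv
        rw [hu] at this
        exact this
      refine ⟨-((u⁻¹ : (End E)ˣ).1 ≫ g ≫ biprod.fst), ?_⟩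
      have := congrArg (fun x => (u⁻¹ : (End E)ˣ).1 ≫ x) hg'
      simp only [Preadditive.comp_add, comp_zero] at this
      rw [← Category.assoc _ (g ≫ biprod.snd), e, Category.id_comp] at this
      rw [Preadditive.neg_comp, Category.assoc, neg_eq_iff_add_eq_zero, ← this]
    rw [h2, zero_comp, add_zero] at hg'
    ext
    · simpa using h _ hg'
    · simpa using h2
  have lt (P : C) : Module.finrank k (E ⟶ P) < Module.finrank k (E ⟶ P ⊞ E) := by
    let φ := Linear.rightComp k E (biprod.inl : P ⟶ P ⊞ E)
    have hφ : Function.Injective φ := by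
      refine (injective_iff_map_eq_zero _).2 fun g hg => ?_
      rw [← cancel_mono (biprod.inl : P ⟶ P ⊞ E), zero_comp]
      exact hg
    have hr : LinearMap.range φ < ⊤ := by
      rw [lt_top_iff_ne_top]
      intro h
      obtain ⟨x, hx⟩ := (LinearMap.range_eq_top.1 h) (biprod.inr : E ⟶ P ⊞ E)
      have hx : x ≫ biprod.inl = biprod.inr := hx
      have := congrArg (fun y => y ≫ biprod.snd) hx
      simp only [Category.assoc, BinaryBicone.inl_snd, comp_zero, BinaryBicone.inr_snd] at this
      exact zero_ne_one (α := End E) this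
    have := hfin (P ⊞ E)
    rw [← LinearMap.finrank_range_of_inj hφ]
    exact Submodule.finrank_lt hr.ne
  -- Induction on a bound `n` for the gap between `dim Hom(E, X)` and `dim Hom(E, P)`.
  have main (n : ℕ) : ∀ (P : C) (p : P ⟶ X), IsFiniteSum E P → (∀ g : E ⟶ P, g ≫ p = 0 → g = 0) →
      Module.finrank k (E ⟶ X) ≤ Module.finrank k (E ⟶ P) + n →
      ∃ (P : C) (p : P ⟶ X), IsApprox E p := by
    induction n with
    | zero =>
      intro P p hP hp hn
      refine ⟨P, p, hP, hp, fun f => ?_⟩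
      by_contra hf
      have h1 := finrank_le _ (step p hp f hf)
      have h2 := lt P
      omega
    | succ n ih =>
      intro P p hP hp hn
      by_cases hs : ∀ f : E ⟶ X, ∃ g : E ⟶ P, g ≫ p = f
      · exact ⟨P, p, hP, hp, hs⟩
      push Not at hs
      obtain ⟨f, hf⟩ := hs
      have h2 := lt P
      exact ih _ (biprod.desc p f) (hP.biprod .self)
        (step p hp f (by push Not; exact hf)) (by omega)
  open ZeroObject in
  exact main _ (0 : C) 0 (.zero (isZero_zero C)) (fun g _ => (isZero_zero C).eq_of_tgt _ _)
    (Nat.le_add_left _ _)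

end Existence

end Perpendicular

/-! ### Realising `Ext¹` classes and universal extensions. -/

section UniversalExtension

open Abelian Pretriangulated

variable {C : Type u} [Category.{v} C] [Abelian C]

open DerivedCategory in
/-- A distinguished triangle in the derived category with two vertices in degree zero comes from
a short exact sequence. -/
lemma exists_shortExact_of_hom [HasDerivedCategory.{w'} C] {X Z : C}
    (e : (singleFunctor C 0).obj Z ⟶ ((singleFunctor C 0).obj X)⟦(1 : ℤ)⟧) :
    ∃ (Y : C) (i : X ⟶ Y) (p : Y ⟶ Z) (w : i ≫ p = 0), (ShortComplex.mk i p w).ShortExact ∧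
      e ≫ ((singleFunctor C 0).map i)⟦(1 : ℤ)⟧' = 0 := by
  -- Complete `e` to a triangle; by the long exact cohomology sequence the middle vertex is
  -- concentrated in degree zero, hence is an object of `C`.
  obtain ⟨Y', f, g, hT⟩ := distinguished_cocone_triangle₂ e
  have hGE : Y'.IsGE 0 := by
    rw [isGE_iff]
    intro n hn
    exact (HomologySequence.exact₂ _ hT n).isZero_of_both_zeros
      ((isZero_of_isGE ((singleFunctor C 0).obj X) 0 n hn).eq_of_src _ _)
      ((isZero_of_isGE ((singleFunctor C 0).obj Z) 0 n hn).eq_of_tgt _ _)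
  have hLE : Y'.IsLE 0 := by
    rw [isLE_iff]
    intro n hn
    exact (HomologySequence.exact₂ _ hT n).isZero_of_both_zeros
      ((isZero_of_isLE ((singleFunctor C 0).obj X) 0 n hn).eq_of_src _ _)
      ((isZero_of_isLE ((singleFunctor C 0).obj Z) 0 n hn).eq_of_tgt _ _)
  obtain ⟨Y, ⟨φ⟩⟩ := exists_iso_singleFunctor_obj_of_isGE_of_isLE Y' 0
  obtain ⟨i, hi⟩ := (singleFunctor C 0).map_surjective (f ≫ φ.hom)
  obtain ⟨p, hp⟩ := (singleFunctor C 0).map_surjective (φ.inv ≫ g)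
  have hfg : f ≫ g = 0 := comp_distTriang_mor_zero₁₂ _ hT
  have hge : e ≫ f⟦(1 : ℤ)⟧' = 0 := comp_distTriang_mor_zero₃₁ _ hT
  have w : i ≫ p = 0 := (singleFunctor C 0).map_injective (by simp [hi, hp, hfg])
  let T' : Triangle (DerivedCategory C) :=
    Triangle.mk ((singleFunctor C 0).map i) ((singleFunctor C 0).map p) e
  have hT' : T' ∈ distTriang _ := by
    refine isomorphic_distinguished _ hT _ (Triangle.isoMk _ _ (Iso.refl _) φ.symm (Iso.refl _)
      ?_ ?_ ?_)
    · change (singleFunctor C 0).map i ≫ φ.inv = 𝟙 _ ≫ f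
      simp [hi]
    · change (singleFunctor C 0).map p ≫ 𝟙 _ = φ.inv ≫ g
      simp [hp]
    · change e ≫ (shiftFunctor (DerivedCategory C) (1 : ℤ)).map (𝟙 _) = 𝟙 _ ≫ e
      simp
  let ι := singleFunctorCompHomologyFunctorIso C 0
  have hm : Mono ((homologyFunctor C 0).map T'.mor₁) :=
    (HomologySequence.mono_homologyMap_mor₁_iff _ hT' (-1) 0).2
      ((isZero_of_isGE ((singleFunctor C 0).obj Z) 0 (-1) (by lia)).eq_of_src _ _)
  have he : Epi ((homologyFunctor C 0).map T'.mor₂) :=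
    (HomologySequence.epi_homologyMap_mor₂_iff _ hT' 0 1).2
      ((isZero_of_isLE ((singleFunctor C 0).obj X) 0 1 (by lia)).eq_of_tgt _ _)
  refine ⟨Y, i, p, w, ?_, ?_⟩
  · refine ShortComplex.shortExact_of_iso (ShortComplex.isoMk (ι.app X) (ι.app Y) (ι.app Z)
      (ι.hom.naturality i).symm (ι.hom.naturality p).symm)
      { exact := HomologySequence.exact₂ _ hT' 0, mono_f := hm, epi_g := he }
  · rw [hi, Functor.map_comp, reassoc_of% hge, zero_comp]

variable [HasExt.{w} C]

lemma exists_shortExact_of_ext {X Z : C} (e : Ext.{w} Z X 1) :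
    ∃ (Y : C) (i : X ⟶ Y) (p : Y ⟶ Z) (w : i ≫ p = 0), (ShortComplex.mk i p w).ShortExact ∧
      e.comp (Ext.mk₀ i) (add_zero 1) = 0 := by
  let := HasDerivedCategory.standard C
  obtain ⟨Y, i, p, w, hS, he⟩ := exists_shortExact_of_hom (e.hom)
  refine ⟨Y, i, p, w, hS, ?_⟩
  ext
  rw [Ext.comp_hom, Ext.mk₀_hom, ShiftedHom.comp_mk₀, Ext.zero_hom]
  exact he

variable {k : Type*} [Field k] [Linear k C] {E : C}

/-- Universal extensions by `E`. -/
lemma exists_universal_extension [HasProjectiveDimensionLE E 1]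
    (hfin : ∀ X : C, Module.Finite k (Ext.{w} E X 1)) (hE : extOneVanish.{w} E E)
    {W : ObjectProperty C} (hW₀ : ∀ ⦃X : C⦄, IsZero X → W X) (hWE : W E)
    (hW₂ : ∀ ⦃S : ShortComplex C⦄, S.ShortExact → W S.X₁ → W S.X₃ → W S.X₂) (X : C) :
    ∃ (Y V : C) (i : X ⟶ Y) (p : Y ⟶ V) (w : i ≫ p = 0), (ShortComplex.mk i p w).ShortExact ∧
      extOneVanish.{w} E Y ∧ W V := by
  induction h : Module.finrank k (Ext.{w} E X 1) using Nat.strong_induction_on generalizing X with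
  | _ n ih =>
  subst h
  by_cases hX : extOneVanish.{w} E X
  · exact ⟨X, _, 𝟙 X, _, _, shortExact_of_isIso (𝟙 X), hX, hW₀ (isZero_zero C)⟩
  obtain ⟨e, he⟩ : ∃ e : Ext.{w} E X 1, e ≠ 0 := by
    by_contra! h
    exact hX (subsingleton_of_forall_eq 0 h)
  obtain ⟨X', i, p, w, hS, hi⟩ := exists_shortExact_of_ext e
  let φ : Ext.{w} E X 1 →ₗ[k] Ext.{w} E X' 1 :=
    (Ext.bilinearCompOfLinear k E X X' 1 0 1 (add_zero 1)).flip (Ext.mk₀ i)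
  -- The map `Ext¹(E, X) ⟶ Ext¹(E, X')` is onto because `Ext¹(E, E) = 0`, and it kills `e ≠ 0`, so
  -- the dimension drops.
  have hφ : Function.Surjective φ := fun x => by
    have : Subsingleton (Ext.{w} E E 1) := hE
    exact Ext.covariant_sequence_exact₂ E hS x (Subsingleton.elim _ _)
  have hlt : Module.finrank k (Ext.{w} E X' 1) < Module.finrank k (Ext.{w} E X 1) := by
    have h1 := LinearMap.finrank_range_add_finrank_ker φ
    rw [LinearMap.range_eq_top.2 hφ, finrank_top] at h1
    have h2 : 0 < Module.finrank k (LinearMap.ker φ) := by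
      have : Nontrivial (LinearMap.ker φ) :=
        ⟨⟨e, hi⟩, 0, fun h => he (congrArg Subtype.val h)⟩
      exact Module.finrank_pos
    omega
  obtain ⟨Y, V, j, q, w', hS', hY, hV⟩ := ih _ hlt X' rfl
  -- The cokernel `R` of the composite `X ⟶ X' ⟶ Y` is an extension of `V` by `E`, so it stays in
  -- `W`.
  obtain ⟨R, a, b, c, wa, wb, ha, hb⟩ := exists_shortExact_shortExact hS hS'
  exact ⟨Y, R, i ≫ j, a, wa, ha, hY, hW₂ hb hWE hV⟩

end UniversalExtension

/-! ### Kernels and cokernels of minimal approximations. -/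

section PerpendicularExtension

variable {C : Type u} [Category.{v} C] [Abelian C]

namespace IsApprox

variable {E : C}

/-- Each approximation factors through the other, and injectivity on maps from sums of `E` forces
the two factorisations to be inverse. -/
lemma exists_iso {P P' X : C} {p : P ⟶ X} {p' : P' ⟶ X} (h : IsApprox E p) (h' : IsApprox E p') :
    ∃ e : P ≅ P', e.hom ≫ p' = p := by
  obtain ⟨a, ha⟩ := h.isFiniteSum.exists_lift h'.exists_lift p
  obtain ⟨b, hb⟩ := h'.isFiniteSum.exists_lift h.exists_lift p'
  refine ⟨⟨a, b, ?_, ?_⟩, ha⟩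
  · rw [← sub_eq_zero]
    exact h.isFiniteSum.comp_injective h.eq_zero _ (by simp [Preadditive.sub_comp, ha, hb])
  · rw [← sub_eq_zero]
    exact h'.isFiniteSum.comp_injective h'.eq_zero _ (by simp [Preadditive.sub_comp, ha, hb])

/-- A horseshoe lemma: approximations of the outer terms combine once `p₃` lifts to `X₂`. -/
lemma biprod {S : ShortComplex C} (hS : S.ShortExact) {P₁ P₃ : C} {p₁ : P₁ ⟶ S.X₁}
    {p₃ : P₃ ⟶ S.X₃} (h₁ : IsApprox E p₁) (h₃ : IsApprox E p₃) {q : P₃ ⟶ S.X₂}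
    (hq : q ≫ S.g = p₃) : IsApprox E (biprod.desc (p₁ ≫ S.f) q) where
  isFiniteSum := h₁.isFiniteSum.biprod h₃.isFiniteSum
  eq_zero g hg := by
    have := hS.mono_f
    have hg' : (g ≫ biprod.fst) ≫ p₁ ≫ S.f + (g ≫ biprod.snd) ≫ q = 0 := by
      rw [← hg, biprod.desc_eq]; simp
    have h2 : g ≫ biprod.snd = 0 := by
      refine h₃.eq_zero _ ?_
      have := congrArg (· ≫ S.g) hg'
      simpa [hq] using this
    rw [h2, zero_comp, add_zero] at hg'
    ext
    · have := h₁.eq_zero (g ≫ biprod.fst) (by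
        rw [← cancel_mono S.f, zero_comp, ← hg', Category.assoc])
      simpa using this
    · simpa using h2
  exists_lift g := by
    obtain ⟨b, hb⟩ := h₃.exists_lift (g ≫ S.g)
    have := hS.mono_f
    have hz : (g - b ≫ q) ≫ S.g = 0 := by simp [Preadditive.sub_comp, hq, hb]
    obtain ⟨a, ha⟩ := h₁.exists_lift (hS.exact.lift _ hz)
    refine ⟨biprod.lift a b, ?_⟩
    rw [biprod.lift_desc, reassoc_of% ha, hS.exact.lift_f]
    abel

variable [HasExt.{w} C] [HasProjectiveDimensionLE E 1] (hE : extOneVanish.{w} E E) {P X : C}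
  {p : P ⟶ X} (hp : IsApprox E p)
include hE hp

lemma extOneVanish_image : extOneVanish.{w} E (image p) :=
  extOneVanish_X₃ (shortExact_kernel_image p) (hp.isFiniteSum.extOneVanish hE)

-- Injectivity of `Hom(E, P) ⟶ Hom(E, X)` kills maps into the kernel. Surjectivity makes every map
-- from `E` to the image lift to `P`, which together with `Ext¹(E, P) = 0` kills `Ext¹` of the
-- kernel.
omit [HasProjectiveDimensionLE E 1] in
lemma perp_kernel : perp.{w} E (kernel p) := by
  refine ⟨fun g => ?_, extOneVanish_X₁ (shortExact_kernel_image p)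
    (hp.isFiniteSum.extOneVanish hE) fun g => ?_⟩
  · rw [← cancel_mono (kernel.ι p), zero_comp]
    exact hp.eq_zero _ (by simp)
  · obtain ⟨g', hg'⟩ := hp.exists_lift (g ≫ image.ι p)
    refine ⟨g', ?_⟩
    rw [← cancel_mono (image.ι p)]
    simpa using hg'

/-- Since `Ext¹(E, image p) = 0`, a map from `E` to the cokernel lifts to `X`, hence factors through
`p`, and so is zero. -/
lemma perp_cokernel (hX : extOneVanish.{w} E X) : perp.{w} E (cokernel p) := by
  refine ⟨fun g => ?_, extOneVanish_X₃ (shortExact_image_cokernel p) hX⟩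
  obtain ⟨g', rfl⟩ := exists_lift_of_extOneVanish (shortExact_image_cokernel p)
    (hp.extOneVanish_image hE) g
  obtain ⟨g'', rfl⟩ := hp.exists_lift g'
  simp

end IsApprox

/-- The alternating sum along the exact snake sequence vanishes; the two extra conditions close it
with zeros at both ends. -/
lemma IsAdditiveOn.map_six_term {U : ObjectProperty C} {f : C → ℤ} (hf : IsAdditiveOn U f)
    (hU : IsWide U) (D : ShortComplex.SnakeInput C) [Mono D.L₁.f] [Epi D.L₂.g]
    (h₁ : U D.L₀.X₁) (h₂ : U D.L₀.X₂) (h₃ : U D.L₀.X₃) (h₁' : U D.L₃.X₁) (h₂' : U D.L₃.X₂)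
    (h₃' : U D.L₃.X₃) :
    f D.L₃.X₂ - f D.L₀.X₂ = (f D.L₃.X₁ - f D.L₀.X₁) + (f D.L₃.X₃ - f D.L₀.X₃) := by
  have e₁ := hf.map_exact hU D.L₀_exact h₁ h₂ h₃
  have e₂ := hf.map_exact hU D.L₁'_exact h₂ h₃ h₁'
  have e₃ := hf.map_exact hU D.L₂'_exact h₃ h₁' h₂'
  have e₄ := hf.map_exact hU D.L₃_exact h₁' h₂' h₃'
  rw [hf.map_image_of_mono hU _ h₁] at e₁
  rw [hf.map_image_of_epi hU D.L₃.g h₂' h₃'] at e₄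
  simp only [ShortComplex.SnakeInput.L₁', ShortComplex.SnakeInput.L₂'] at e₂ e₃
  omega

end PerpendicularExtension

/-! ### Passing from `E^⊥` to the ambient wide subcategory. -/

section PerpendicularExtension

open Abelian

variable {C : Type u} [Category.{v} C] [Abelian C] [HasExt.{w} C]

/-- Additive functions on `A ∩ E^⊥` extend to `A ∩ {X | Ext¹(E, X) = 0}`. -/
lemma exists_isAdditiveOn_extOneVanish {A : ObjectProperty C} (hA : IsWide A) {E : C}
    (hEA : A E) [HasProjectiveDimensionLE E 1] (hE : extOneVanish.{w} E E)
    (happrox : ∀ X : C, ∃ (P : C) (p : P ⟶ X), IsApprox E p) {f : C → ℤ}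
    (hf : IsAdditiveOn (fun X => A X ∧ perp.{w} E X) f) :
    ∃ g : C → ℤ, IsAdditiveOn (fun X => A X ∧ extOneVanish.{w} E X) g ∧
      (∀ X, A X → perp.{w} E X → g X = f X) ∧ g E = 0 := by
  choose P p hp using happrox
  have hU := hA.inf (isWide_perp.{w} E)
  have hker {P X : C} {p : P ⟶ X} (h : IsApprox E p) (hX : A X) :
      A (kernel p) ∧ perp.{w} E (kernel p) :=
    ⟨hA.kernel p (h.isFiniteSum.prop hA hEA) hX, h.perp_kernel hE⟩
  have hcoker {P X : C} {p : P ⟶ X} (h : IsApprox E p) (hX : A X) (hX' : extOneVanish.{w} E X) :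
      A (cokernel p) ∧ perp.{w} E (cokernel p) :=
    ⟨hA.cokernel p (h.isFiniteSum.prop hA hEA) hX, h.perp_cokernel hE hX'⟩
  -- This is the value forced by additivity and `g E = 0`, since the approximating object is a sum
  -- of copies of `E`.
  let g : C → ℤ := fun X => f (cokernel (p X)) - f (kernel (p X))
  have hg {P X : C} {q : P ⟶ X} (h : IsApprox E q) (hX : A X) (hX' : extOneVanish.{w} E X) :
      g X = f (cokernel q) - f (kernel q) := by
    obtain ⟨e, he⟩ := h.exists_iso (hp X)
    have e₁ : kernel q ≅ kernel (p X) := kernel.mapIso q (p X) e (Iso.refl X) (by simp [he])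
    have e₂ : cokernel q ≅ cokernel (p X) :=
      cokernel.mapIso q (p X) e (Iso.refl X) (by simp [he])
    rw [hf.congr_of_iso hU e₁ (hker h hX), hf.congr_of_iso hU e₂ (hcoker h hX hX')]
  refine ⟨g, ?_, ?_, ?_⟩
  · intro S hS h₁ h₂ h₃
    have := hS.mono_f
    have := hS.epi_g
    obtain ⟨q, hq⟩ := (hp S.X₃).isFiniteSum.exists_lift (exists_lift_of_extOneVanish hS h₁.2)
      (p S.X₃)
    have hb := IsApprox.biprod hS (hp S.X₁) (hp S.X₃) hq
    let L₁ : ShortComplex C := ShortComplex.mk (biprod.inl : P S.X₁ ⟶ P S.X₁ ⊞ P S.X₃)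
      biprod.snd (by simp)
    have hL₁ : L₁.ShortExact := (ShortComplex.Splitting.ofHasBinaryBiproduct _ _).shortExact
    let φ : L₁ ⟶ S :=
      { τ₁ := p S.X₁
        τ₂ := biprod.desc (p S.X₁ ≫ S.f) q
        τ₃ := p S.X₃
        comm₁₂ := by simp [L₁]
        comm₂₃ := by dsimp [L₁]; ext <;> simp [hq] }
    -- The snake lemma for the split sequence of approximations mapping to `S` yields the six-term
    -- sequence of kernels and cokernels.
    let D : ShortComplex.SnakeInput C :=
      { L₀ := kernel φ
        L₁ := L₁
        L₂ := S
        L₃ := cokernel φ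
        v₀₁ := kernel.ι φ
        v₁₂ := φ
        v₂₃ := cokernel.π φ
        w₀₂ := kernel.condition φ
        w₁₃ := cokernel.condition φ
        h₀ := kernelIsKernel φ
        h₃ := cokernelIsCokernel φ
        L₁_exact := hL₁.exact
        epi_L₁_g := hL₁.epi_g
        L₂_exact := hS.exact
        mono_L₂_f := hS.mono_f }
    have : Mono D.L₁.f := hL₁.mono_f
    have : Epi D.L₂.g := hS.epi_g
    have k₁ : kernel (p S.X₁) ≅ D.L₀.X₁ :=
      IsLimit.conePointUniqueUpToIso (kernelIsKernel _) D.h₀τ₁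
    have k₂ : kernel (biprod.desc (p S.X₁ ≫ S.f) q) ≅ D.L₀.X₂ :=
      IsLimit.conePointUniqueUpToIso (kernelIsKernel _) D.h₀τ₂
    have k₃ : kernel (p S.X₃) ≅ D.L₀.X₃ :=
      IsLimit.conePointUniqueUpToIso (kernelIsKernel _) D.h₀τ₃
    have c₁ : cokernel (p S.X₁) ≅ D.L₃.X₁ :=
      IsColimit.coconePointUniqueUpToIso (cokernelIsCokernel _) D.h₃τ₁
    have c₂ : cokernel (biprod.desc (p S.X₁ ≫ S.f) q) ≅ D.L₃.X₂ :=
      IsColimit.coconePointUniqueUpToIso (cokernelIsCokernel _) D.h₃τ₂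
    have c₃ : cokernel (p S.X₃) ≅ D.L₃.X₃ :=
      IsColimit.coconePointUniqueUpToIso (cokernelIsCokernel _) D.h₃τ₃
    have uk₁ := hker (hp S.X₁) h₁.1
    have uk₂ := hker hb h₂.1
    have uk₃ := hker (hp S.X₃) h₃.1
    have uc₁ := hcoker (hp S.X₁) h₁.1 h₁.2
    have uc₂ := hcoker hb h₂.1 h₂.2
    have uc₃ := hcoker (hp S.X₃) h₃.1 h₃.2
    rw [hg (hp S.X₁) h₁.1 h₁.2, hg hb h₂.1 h₂.2, hg (hp S.X₃) h₃.1 h₃.2,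
      hf.congr_of_iso hU k₁ uk₁, hf.congr_of_iso hU k₂ uk₂, hf.congr_of_iso hU k₃ uk₃,
      hf.congr_of_iso hU c₁ uc₁, hf.congr_of_iso hU c₂ uc₂, hf.congr_of_iso hU c₃ uc₃]
    exact hf.map_six_term hU D (hU.of_iso k₁ uk₁) (hU.of_iso k₂ uk₂) (hU.of_iso k₃ uk₃)
      (hU.of_iso c₁ uc₁) (hU.of_iso c₂ uc₂) (hU.of_iso c₃ uc₃)
  · intro X hX hX'
    open ZeroObject in
    have h0 : IsApprox E (0 : (0 : C) ⟶ X) :=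
      ⟨.zero (isZero_zero C), fun g _ => (isZero_zero C).eq_of_tgt _ _,
        fun g => ⟨0, by rw [hX'.1 g, comp_zero]⟩⟩
    have hz : IsZero (kernel (0 : (0 : C) ⟶ X)) :=
      (isZero_zero C).of_iso (kernelZeroIsoSource)
    rw [hg h0 hX hX'.2, hf.map_isZero hU hz, sub_zero]
    exact (hf.congr_of_iso hU (cokernelZeroIsoTarget (X := (0 : C))).symm ⟨hX, hX'⟩).symm
  · have h1 : IsApprox E (𝟙 E) := ⟨.self, fun g hg => by simpa using hg, fun g => ⟨g, by simp⟩⟩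
    rw [hg h1 hEA hE, hf.map_isZero hU (isZero_cokernel_of_epi _),
      hf.map_isZero hU (isZero_kernel_of_mono _), sub_zero]

variable {k : Type*} [Field k] [Linear k C]

/-- Additive functions on `A ∩ E^⊥` extend to `A`. -/
lemma exists_isAdditiveOn_of_perp {A : ObjectProperty C} (hA : IsWide A) {E : C}
    (hEA : A E) [HasProjectiveDimensionLE E 1] (hE : extOneVanish.{w} E E)
    (happrox : ∀ X : C, ∃ (P : C) (p : P ⟶ X), IsApprox E p)
    (hfin : ∀ X : C, Module.Finite k (Ext.{w} E X 1)) {f : C → ℤ}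
    (hf : IsAdditiveOn (fun X => A X ∧ perp.{w} E X) f) :
    ∃ g : C → ℤ, IsAdditiveOn A g ∧ (∀ X, A X → perp.{w} E X → g X = f X) ∧ g E = 0 := by
  obtain ⟨g, hg, hgf, hgE⟩ := exists_isAdditiveOn_extOneVanish hA hEA hE happrox hf
  obtain ⟨h, hh, hhg⟩ := exists_isAdditiveOn_of_coresolution hA
    (V := fun X => A X ∧ extOneVanish.{w} E X) (fun X hX => hX.1)
    (fun S hS h₁ h₃ => ⟨hA.prop_X₂ hS h₁.1 h₃.1, extOneVanish_X₂ hS h₁.2 h₃.2⟩)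
    (fun S hS h₂ h₃ => ⟨h₃, extOneVanish_X₃ hS h₂.2⟩)
    (fun X hX => ⟨hA.zero hX, extOneVanish_of_isZero hX⟩)
    (fun X hX => by
      obtain ⟨Y, V, i, p, w, hS, hY, hV⟩ := exists_universal_extension hfin hE (W := A)
        (fun _ => hA.zero) hEA (fun _ => hA.prop_X₂) X
      exact ⟨Y, V, i, p, w, hS, ⟨hA.prop_X₂ hS hX hV, hY⟩, hV⟩) hg
  refine ⟨h, hh, fun X hX hX' => ?_, ?_⟩
  · rw [hhg X ⟨hX, hX'.2⟩, hgf X hX hX']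
  · rw [hhg E ⟨hEA, hE⟩, hgE]

/-- A property with the two out of three property for short exact sequences holds on `A` if it
holds for `E` and on `A ∩ E^⊥`. -/
lemma prop_of_perp {A : ObjectProperty C} (hA : IsWide A) {E : C}
    (hEA : A E) [HasProjectiveDimensionLE E 1] (hE : extOneVanish.{w} E E)
    (happrox : ∀ X : C, ∃ (P : C) (p : P ⟶ X), IsApprox E p)
    (hfin : ∀ X : C, Module.Finite k (Ext.{w} E X 1)) {Q : ObjectProperty C}
    (hQ₀ : ∀ ⦃X : C⦄, IsZero X → Q X)
    (hQ₁ : ∀ ⦃S : ShortComplex C⦄, S.ShortExact → Q S.X₂ → Q S.X₃ → Q S.X₁)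
    (hQ₂ : ∀ ⦃S : ShortComplex C⦄, S.ShortExact → Q S.X₁ → Q S.X₃ → Q S.X₂)
    (hQ₃ : ∀ ⦃S : ShortComplex C⦄, S.ShortExact → Q S.X₁ → Q S.X₂ → Q S.X₃)
    (hQE : Q E) (hQ : ∀ X, A X → perp.{w} E X → Q X) (X : C) (hX : A X) : Q X := by
  -- Running the universal extension inside `A ∩ Q` puts the cokernel `V` in `Q`, so only `Q Y`
  -- remains.
  obtain ⟨Y, V, i, p, w, hS, hY, hV⟩ := exists_universal_extension hfin hE
    (W := fun X => A X ∧ Q X) (fun _ h => ⟨hA.zero h, hQ₀ h⟩) ⟨hEA, hQE⟩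
    (fun _ hS h h' => ⟨hA.prop_X₂ hS h.1 h'.1, hQ₂ hS h.2 h'.2⟩) X
  have hYA : A Y := hA.prop_X₂ hS hX hV.1
  obtain ⟨P, q, hq⟩ := happrox Y
  have hsum {P : C} (hP : IsFiniteSum E P) : Q P := by
    induction hP with
    | zero hX => exact hQ₀ hX
    | self => exact hQE
    | biprod _ _ h h' =>
      exact hQ₂ (ShortComplex.Splitting.ofHasBinaryBiproduct _ _).shortExact h h'
  have hP := hsum hq.isFiniteSum
  have hPA := hq.isFiniteSum.prop hA hEA
  have hK : Q (kernel q) := hQ _ (hA.kernel q hPA hYA) (hq.perp_kernel hE)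
  have hI : Q (image q) := hQ₃ (shortExact_kernel_image q) hK hP
  have hQY : Q Y := hQ₂ (shortExact_image_cokernel q) hI
    (hQ _ (hA.cokernel q hPA hYA) (hq.perp_cokernel hE hY))
  exact hQ₁ hS hQY hV.2

/-- The additive function `X ↦ ∑ (-1)ⁱ dim Extⁱ(E, X)` if `E` has projective dimension at most
one, described on the objects with `Ext¹(E, X) = 0`. -/
lemma exists_isAdditiveOn_finrank {E : C} [HasProjectiveDimensionLE E 1]
    (hE : extOneVanish.{w} E E) (hfin₀ : ∀ X : C, Module.Finite k (E ⟶ X))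
    (hfin : ∀ X : C, Module.Finite k (Ext.{w} E X 1)) :
    ∃ g : C → ℤ, IsAdditiveOn (fun _ => True) g ∧
      ∀ X, extOneVanish.{w} E X → g X = Module.finrank k (E ⟶ X) := by
  have hA : IsWide (fun _ : C => True) := by constructor <;> intros <;> trivial
  have hf : IsAdditiveOn (extOneVanish.{w} E) (fun X => (Module.finrank k (E ⟶ X) : ℤ)) := by
    intro S hS h₁ h₂ h₃
    have := hS.mono_f
    have hinj : Function.Injective (Linear.rightComp k E S.f) := fun a b h =>
      (cancel_mono S.f).1 h
    have hsurj : Function.Surjective (Linear.rightComp k E S.g) :=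
      exists_lift_of_extOneVanish hS h₁
    have hex : LinearMap.range (Linear.rightComp k E S.f) =
        LinearMap.ker (Linear.rightComp k E S.g) := by
      ext x
      constructor
      · rintro ⟨y, rfl⟩
        change (y ≫ S.f) ≫ S.g = 0
        simp
      · intro hx
        exact ⟨hS.exact.lift x hx, hS.exact.lift_f x hx⟩
    have h := LinearMap.finrank_range_add_finrank_ker (Linear.rightComp k E S.g)
    rw [LinearMap.range_eq_top.2 hsurj, finrank_top, ← hex,
      LinearMap.finrank_range_of_inj hinj] at h
    dsimp only
    omega
  exact exists_isAdditiveOn_of_coresolution hA (fun _ _ => trivial)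
    (fun S hS => extOneVanish_X₂ hS) (fun S hS h _ => extOneVanish_X₃ hS h)
    (fun X hX => extOneVanish_of_isZero hX)
    (fun X _ => by
      obtain ⟨Y, V, i, p, w, hS, hY, hV⟩ := exists_universal_extension hfin hE
        (W := fun _ => True) (fun _ _ => trivial) trivial (fun _ _ _ _ => trivial) X
      exact ⟨Y, V, i, p, w, hS, hY, trivial⟩) hf

end PerpendicularExtension

/-! ### Additive functions from the Krull filtration. -/

section KrullDimension

variable {C : Type u} [Category.{v} C] [Abelian C]

/-- For a Serre subcategory `P`, the length in the quotient by `P` is additive on the objects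
which have finite length in the quotient. -/
lemma exists_isAdditiveOn_finiteLengthModSerre (P : ObjectProperty C) [P.IsSerreClass] :
    ∃ f : C → ℤ, IsAdditiveOn (finiteLengthModSerre P) f ∧
      ∀ X, finiteLengthModSerre P X → f X = 0 → P X := by
  let : Abelian P.isoModSerre.Localization :=
    ObjectProperty.SerreClassLocalization.abelian P.isoModSerre.Q P
  have := ObjectProperty.SerreClassLocalization.preservesFiniteLimits P.isoModSerre.Q P
  have := ObjectProperty.SerreClassLocalization.preservesFiniteColimits P.isoModSerre.Q P
  refine ⟨fun X => ((objLength (P.isoModSerre.Q.obj X)).toNat : ℤ), ?_, ?_⟩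
  · intro S hS h₁ _ h₃
    have h : objLength (P.isoModSerre.Q.obj S.X₂) = objLength (P.isoModSerre.Q.obj S.X₁) +
        objLength (P.isoModSerre.Q.obj S.X₃) :=
      objLength_eq_add (hS.map_of_exact P.isoModSerre.Q)
    have h' := ENat.toNat_add (objLength_ne_top h₁) (objLength_ne_top h₃)
    dsimp only
    rw [h, h', Nat.cast_add]
  · intro X hX h
    dsimp only at h
    rw [← ObjectProperty.SerreClassLocalization.isZero_obj_iff P.isoModSerre.Q P,
      ← objLength_eq_zero_iff, ← ENat.natCast_toNat (objLength_ne_top hX)]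
    exact_mod_cast h

/-- If `C` has finite Krull dimension, then every class of objects which contains a nonzero
object carries a nonzero additive function. -/
lemma exists_isAdditiveOn_ne_zero (hC : HasFiniteKrullDimension C) {A : ObjectProperty C} {X : C}
    (hX : A X) (hX0 : ¬ IsZero X) : ∃ f : C → ℤ, IsAdditiveOn A f ∧ ∃ Y, A Y ∧ f Y ≠ 0 := by
  classical
  have hex : ∃ n, A ≤ krullFiltration C n := hC.imp fun n hn X _ => hn X
  -- At the first stage `m` containing `A`, a nonzero object excludes `m = 0`. If length modulo the
  -- preceding stage vanished on `A`, then `A` would already lie in that stage.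
  obtain ⟨m, hm, hmin⟩ : ∃ m, A ≤ krullFiltration C m ∧ ∀ l < m, ¬ A ≤ krullFiltration C l :=
    ⟨Nat.find hex, Nat.find_spec hex, fun l => Nat.find_min hex⟩
  obtain _ | p := m
  · exact absurd (hm X hX) hX0
  have : (krullFiltration C p).IsSerreClass := (krullFiltrationAux C p).2
  have hm : A ≤ finiteLengthModSerre (krullFiltration C p) := hm
  obtain ⟨f, hf, hf0⟩ := exists_isAdditiveOn_finiteLengthModSerre (krullFiltration C p)
  refine ⟨f, fun S hS h₁ h₂ h₃ => hf hS (hm _ h₁) (hm _ h₂) (hm _ h₃), ?_⟩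
  by_contra! h
  exact hmin p p.lt_succ_self fun Y hY => hf0 Y (hm _ hY) (h Y hY)

end KrullDimension

/-! ### Additive functions as homomorphisms on `K₀`. -/

section GrothendieckGroup

variable {C : Type u} [Category.{v} C] [Abelian C]

/-- The homomorphism on the Grothendieck group defined by an additive function. -/
lemma exists_K₀_hom {f : C → ℤ} (hf : IsAdditiveOn (fun _ => True) f) :
    ∃ φ : K₀ C →+ ℤ, ∀ X : C, φ (QuotientAddGroup.mk (FreeAbelianGroup.of X)) = f X := by
  refine ⟨QuotientAddGroup.lift (K₀Relations C) (FreeAbelianGroup.lift f) ?_, fun X => ?_⟩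
  · rw [K₀Relations, AddSubgroup.closure_le]
    rintro _ ⟨S, hS, rfl⟩
    have := hf hS trivial trivial trivial
    simp [this]
  · simp

end GrothendieckGroup

/-! ### Peeling off the exceptional collection; vanishing of its perpendicular category. -/

section ExceptionalCollection

open Abelian

variable {C : Type u} [Category.{v} C] [Abelian C] [HasExt.{w} C]

lemma subsingleton_hom_of_ext {X Y : C} (h : Subsingleton (Ext.{w} X Y 0)) (f : X ⟶ Y) : f = 0 :=
  (Ext.mk₀_bijective X Y).1 (Subsingleton.elim _ _)

/-- The objects which are right perpendicular to `T j` for all `j < m`. -/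
def perpBelow {n : ℕ} (T : Fin n → C) (m : ℕ) : ObjectProperty C :=
  fun X => ∀ j : Fin n, (j : ℕ) < m → perp.{w} (T j) X

variable {n : ℕ} {T : Fin n → C}

lemma perpBelow_succ {m : ℕ} (hm : m < n) {X : C} :
    perpBelow.{w} T (m + 1) X ↔ perpBelow.{w} T m X ∧ perp.{w} (T ⟨m, hm⟩) X := by
  constructor
  · intro h
    exact ⟨fun j hj => h j (by omega), h ⟨m, hm⟩ (by simp)⟩
  · rintro ⟨h, h'⟩ j hj
    rcases Nat.lt_succ_iff_lt_or_eq.1 hj with hj | hj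
    · exact h j hj
    · obtain rfl : j = ⟨m, hm⟩ := Fin.ext hj
      exact h'

lemma isWide_perpBelow (hpd : ∀ i, HasProjectiveDimensionLE (T i) 1) (m : ℕ) :
    IsWide (perpBelow.{w} T m) :=
  isWide_iInf fun j => isWide_iInf fun _ => have := hpd j; isWide_perp.{w} (T j)

lemma IsExceptionalCollection.perpBelow_self (hT : IsExceptionalCollection.{w} T) (i : Fin n) :
    perpBelow.{w} T i (T i) := fun j hj =>
  ⟨subsingleton_hom_of_ext (hT.ext_of_lt j i hj 0), hT.ext_of_lt j i hj 1⟩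

variable {k : Type*} [Field k] [Linear k C]

lemma IsExceptionalCollection.exists_isApprox (hC : IsExtFinite.{w} k C)
    (hT : IsExceptionalCollection.{w} T) (i : Fin n) (X : C) :
    ∃ (P : C) (p : P ⟶ X), IsApprox (T i) p :=
  TiltingTheory.exists_isApprox (k := k) (hC.finite_hom _) (hT.isExceptional i).nontrivial_end
    (hT.isExceptional i).isUnit_of_ne_zero X

/-- Additive functions on the right perpendicular category of an exceptional collection extend
to additive functions vanishing on the collection. -/
lemma IsExceptionalCollection.exists_isAdditiveOn (hC : IsExtFinite.{w} k C)
    (hT : IsExceptionalCollection.{w} T) (hpd : ∀ i, HasProjectiveDimensionLE (T i) 1)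
    {f : C → ℤ} (hf : IsAdditiveOn (perpBelow.{w} T n) f) (d m : ℕ) (hd : m + d = n) :
    ∃ g : C → ℤ, IsAdditiveOn (perpBelow.{w} T m) g ∧ (∀ X, perpBelow.{w} T n X → g X = f X) ∧
      ∀ j : Fin n, m ≤ j → g (T j) = 0 := by
  induction d generalizing m with
  | zero =>
    obtain rfl : m = n := hd
    exact ⟨f, hf, fun _ _ => rfl, fun j hj => absurd j.2 (by omega)⟩
  | succ d ih =>
    obtain ⟨g, hg, hgf, hgT⟩ := ih (m + 1) (by omega)
    have hm : m < n := by omega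
    have := hpd ⟨m, hm⟩
    obtain ⟨h, hh, hhg, hhE⟩ := exists_isAdditiveOn_of_perp (isWide_perpBelow.{w} hpd m)
      (hT.perpBelow_self ⟨m, hm⟩) ((hT.isExceptional ⟨m, hm⟩).ext_self 1 one_pos)
      (hT.exists_isApprox hC _) (fun X => hC.finite_ext _ X 1) (f := g)
      (fun S hS h₁ h₂ h₃ => hg hS ((perpBelow_succ hm).2 h₁) ((perpBelow_succ hm).2 h₂)
        ((perpBelow_succ hm).2 h₃))
    refine ⟨h, hh, fun X hX => ?_, fun j hj => ?_⟩
    · rw [hhg X (fun j hj => hX j j.2) (hX _ hm), hgf X hX]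
    · rcases hj.lt_or_eq with hj | hj
      -- For `j > m` the object `T j` lies in the smaller perpendicular category, where `h` agrees
      -- with `g`; the value at `T m` itself is zero by the choice of `h`.
      · have := (perpBelow_succ hm).1 (fun i hi => hT.perpBelow_self j i (by omega) :
          perpBelow.{w} T (m + 1) (T j))
        rw [hhg _ this.1 this.2, hgT j hj]
      · obtain rfl : j = ⟨m, hm⟩ := Fin.ext hj.symm
        exact hhE

/-- A property with the two out of three property for short exact sequences which holds for an
exceptional collection and on its right perpendicular category holds for all objects. -/
lemma IsExceptionalCollection.prop_of_perp (hC : IsExtFinite.{w} k C)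
    (hT : IsExceptionalCollection.{w} T) (hpd : ∀ i, HasProjectiveDimensionLE (T i) 1)
    {Q : ObjectProperty C} (hQ₀ : ∀ ⦃X : C⦄, IsZero X → Q X)
    (hQ₁ : ∀ ⦃S : ShortComplex C⦄, S.ShortExact → Q S.X₂ → Q S.X₃ → Q S.X₁)
    (hQ₂ : ∀ ⦃S : ShortComplex C⦄, S.ShortExact → Q S.X₁ → Q S.X₃ → Q S.X₂)
    (hQ₃ : ∀ ⦃S : ShortComplex C⦄, S.ShortExact → Q S.X₁ → Q S.X₂ → Q S.X₃)
    (hQT : ∀ i, Q (T i)) (hQ : ∀ X, perpBelow.{w} T n X → Q X) (X : C) : Q X := by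
  have main (d m : ℕ) (hd : m + d = n) : ∀ X, perpBelow.{w} T m X → Q X := by
    induction d generalizing m with
    | zero =>
      obtain rfl : m = n := hd
      exact hQ
    | succ d ih =>
      have hm : m < n := by omega
      have := hpd ⟨m, hm⟩
      exact TiltingTheory.prop_of_perp (isWide_perpBelow.{w} hpd m)
        (hT.perpBelow_self ⟨m, hm⟩) ((hT.isExceptional ⟨m, hm⟩).ext_self 1 one_pos)
        (hT.exists_isApprox hC _) (fun X => hC.finite_ext _ X 1) hQ₀ hQ₁ hQ₂ hQ₃ (hQT _)
        (fun X hX hX' => ih (m + 1) (by omega) X ((perpBelow_succ hm).2 ⟨hX, hX'⟩))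
  exact main n 0 (zero_add n) X fun j hj => absurd hj (Nat.not_lt_zero _)

/-- If the rank of the Grothendieck group is the length of the collection, then the right
perpendicular category vanishes. -/
lemma IsExceptionalCollection.isZero_of_perp (hC : IsExtFinite.{w} k C)
    (hKrull : HasFiniteKrullDimension C)
    (hT : IsExceptionalCollection.{w} T) (hpd : ∀ i, HasProjectiveDimensionLE (T i) 1)
    (hext : ∀ i j, Subsingleton (Ext.{w} (T i) (T j) 1))
    (hrank : Module.rank ℤ (K₀ C) = (n : Cardinal)) {X : C} (hX : perpBelow.{w} T n X) :
    IsZero X := by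
  by_contra hX0
  obtain ⟨f, hf, Y, hY, hfY⟩ := exists_isAdditiveOn_ne_zero hKrull hX hX0
  obtain ⟨g, hg, hgf, hgT⟩ := hT.exists_isAdditiveOn hC hpd hf n 0 (zero_add n)
  have hg' : IsAdditiveOn (fun _ => True) g := fun S hS _ _ _ =>
    hg hS (fun _ h => absurd h (Nat.not_lt_zero _)) (fun _ h => absurd h (Nat.not_lt_zero _))
      (fun _ h => absurd h (Nat.not_lt_zero _))
  obtain ⟨φ, hφ⟩ := exists_K₀_hom hg'
  -- The Euler form with `T i` in the first variable; on each `T j` it is just `dim Hom(T i, T j)`,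
  -- because `Ext¹(T i, T j) = 0`.
  have hχ (i : Fin n) : ∃ χ : K₀ C →+ ℤ, ∀ X, extOneVanish.{w} (T i) X →
      χ (QuotientAddGroup.mk (FreeAbelianGroup.of X)) = Module.finrank k (T i ⟶ X) := by
    have := hpd i
    obtain ⟨χ, h, h'⟩ := exists_isAdditiveOn_finrank (k := k) (E := T i) (hext i i)
      (hC.finite_hom _) (fun X => hC.finite_ext _ X 1)
    obtain ⟨χ', h''⟩ := exists_K₀_hom h
    exact ⟨χ', fun X hX => by rw [h'', h' X hX]⟩
  choose χ hχ using hχ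
  let v : Option (Fin n) → K₀ C := fun o =>
    QuotientAddGroup.mk (FreeAbelianGroup.of (o.elim Y T))
  have hv : LinearIndependent ℤ v := by
    rw [Fintype.linearIndependent_iff]
    intro c hc
    rw [Fintype.sum_option] at hc
    -- `φ` kills every `T i` and is nonzero on `Y`.
    have h0 : c none = 0 := by
      have := congrArg φ hc
      simp only [map_add, map_sum, map_zsmul, v, hφ, Option.elim, hgT _ (Nat.zero_le _),
        mul_zero, Finset.sum_const_zero, add_zero, map_zero, smul_eq_mul, hgf Y hY] at this
      exact (mul_eq_zero.1 this).resolve_right hfY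
    rw [h0, zero_smul, zero_add] at hc
    -- Apply `χ m`: terms with `j < m` vanish by induction, terms with `j > m` because `Hom(T m, T
    -- j) = 0`, and the diagonal coefficient is `dim End(T m) > 0`.
    have key (m : ℕ) (hm : m < n) : c (some ⟨m, hm⟩) = 0 := by
      induction m using Nat.strong_induction_on with
      | _ m ih =>
      have := congrArg (χ ⟨m, hm⟩) hc
      simp only [map_sum, map_zsmul, v, Option.elim, hχ _ _ (hext _ _), map_zero,
        smul_eq_mul] at this
      rw [Finset.sum_eq_single ⟨m, hm⟩] at this
      · refine (mul_eq_zero.1 this).resolve_right ?_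
        have := (hT.isExceptional ⟨m, hm⟩).nontrivial_end
        have : Nontrivial (T ⟨m, hm⟩ ⟶ T ⟨m, hm⟩) := this
        have := hC.finite_hom (T ⟨m, hm⟩) (T ⟨m, hm⟩)
        exact_mod_cast (Module.finrank_pos (R := k) (M := T ⟨m, hm⟩ ⟶ T ⟨m, hm⟩)).ne'
      · intro j _ hj
        rcases lt_or_gt_of_ne (fun h => hj (Fin.ext h) : (j : ℕ) ≠ m) with hj | hj
        · rw [ih j hj j.2, zero_mul]
        · have : Subsingleton (T ⟨m, hm⟩ ⟶ T j) := subsingleton_of_forall_eq 0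
            (subsingleton_hom_of_ext (hT.ext_of_lt ⟨m, hm⟩ j hj 0))
          rw [Module.finrank_zero_of_subsingleton, Nat.cast_zero, mul_zero]
      · simp
    rintro (_ | ⟨m, hm⟩)
    · exact h0
    · exact key m hm
  have h := hv.cardinal_lift_le_rank
  rw [hrank] at h
  simp only [Cardinal.mk_fintype, Fintype.card_option, Fintype.card_fin, Cardinal.lift_natCast]
    at h
  exact absurd (Nat.cast_le.1 h) (by omega)

end ExceptionalCollection

/-! ### Generation and vanishing in the bounded derived category. -/

section BoundedDerived

open Abelian Pretriangulated DerivedCategory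

/-- Distinguished triangles whose vertices lie in a triangulated subcategory are distinguished
there. -/
lemma exists_distTriang_fullSubcategory {D : Type*} [Category* D] [HasZeroObject D]
    [HasShift D ℤ] [Preadditive D] [∀ n : ℤ, (shiftFunctor D n).Additive] [Pretriangulated D]
    (P : ObjectProperty D) [P.IsTriangulated] {X Y Z : D} {f : X ⟶ Y} {g : Y ⟶ Z}
    {h : Z ⟶ X⟦(1 : ℤ)⟧} (hT : Triangle.mk f g h ∈ distTriang D) (hX : P X) (hY : P Y)
    (hZ : P Z) :
    ∃ (f' : (⟨X, hX⟩ : P.FullSubcategory) ⟶ ⟨Y, hY⟩)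
      (g' : (⟨Y, hY⟩ : P.FullSubcategory) ⟶ ⟨Z, hZ⟩)
      (h' : (⟨Z, hZ⟩ : P.FullSubcategory) ⟶ (⟨X, hX⟩ : P.FullSubcategory)⟦(1 : ℤ)⟧),
        Triangle.mk f' g' h' ∈ distTriang P.FullSubcategory := by
  let X' : P.FullSubcategory := ⟨X, hX⟩
  let Z' : P.FullSubcategory := ⟨Z, hZ⟩
  let h' : P.ι.obj Z' ⟶ P.ι.obj (X'⟦(1 : ℤ)⟧) :=
    CategoryStruct.comp (Y := X⟦(1 : ℤ)⟧) h ((P.ι.commShiftIso (1 : ℤ)).inv.app X')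
  refine ⟨P.homMk f, P.homMk g, P.fullyFaithfulι.preimage h', ?_⟩
  refine isomorphic_distinguished _ hT _ (Triangle.isoMk _ _ (Iso.refl _) (Iso.refl _)
    (Iso.refl _) ?_ ?_ ?_)
  · change f ≫ 𝟙 _ = 𝟙 _ ≫ f
    simp
  · change g ≫ 𝟙 _ = 𝟙 _ ≫ g
    simp
  · change (P.ι.map (P.fullyFaithfulι.preimage h') ≫
      (P.ι.commShiftIso (1 : ℤ)).hom.app X') ≫ (𝟙 X)⟦(1 : ℤ)⟧' = 𝟙 Z ≫ h
    rw [P.fullyFaithfulι.map_preimage, Category.assoc, Category.id_comp]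
    refine (Category.assoc _ _ _).trans ?_
    rw [Iso.inv_hom_id_app_assoc]
    exact (congrArg (h ≫ ·) ((shiftFunctor D (1 : ℤ)).map_id X)).trans (Category.comp_id h)

variable {C : Type u} [Category.{v} C] [Abelian C] [HasDerivedCategory.{w'} C]

/-- A short exact sequence yields a distinguished triangle in the bounded derived category. -/
lemma exists_distTriang_toBounded {S : ShortComplex C} (hS : S.ShortExact) :
    ∃ (f : toBounded.{w'} S.X₁ ⟶ toBounded.{w'} S.X₂)
      (g : toBounded.{w'} S.X₂ ⟶ toBounded.{w'} S.X₃)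
      (h : toBounded.{w'} S.X₃ ⟶ (toBounded.{w'} S.X₁)⟦(1 : ℤ)⟧),
        Triangle.mk f g h ∈ distTriang (BoundedDerivedCategory.{w'} C) :=
  exists_distTriang_fullSubcategory _ hS.singleTriangle_distinguished _ _ _

/-- A triangulated subcategory of the bounded derived category which contains the objects
concentrated in degree zero is everything. -/
lemma prop_of_prop_toBounded (P : ObjectProperty (BoundedDerivedCategory.{w'} C))
    [P.IsTriangulated] [P.IsClosedUnderIsomorphisms] (hP : ∀ X : C, P (toBounded.{w'} X))
    (X : BoundedDerivedCategory.{w'} C) : P X := by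
  let B := (TStructure.t (C := C)).bounded
  have single (X : DerivedCategory C) (hX : B X) (a : ℤ) (h₁ : X.IsGE a) (h₂ : X.IsLE a) :
      P ⟨X, hX⟩ := by
    obtain ⟨Y, ⟨e⟩⟩ := exists_iso_singleFunctor_obj_of_isGE_of_isLE X a
    have e₁ : B.ι.obj ((toBounded.{w'} Y)⟦-a⟧) ≅ B.ι.obj ⟨X, hX⟩ :=
      (B.ι.commShiftIso (-a)).app (toBounded.{w'} Y) ≪≫
        ((singleFunctors C).shiftIso (-a) a 0 (by lia)).app Y ≪≫ e.symm
    exact P.prop_of_iso (B.fullyFaithfulι.preimageIso e₁) (P.le_shift (-a) _ (hP Y))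
  -- Induction on the cohomological amplitude: the truncation triangle at `a` splits off the lowest
  -- cohomology, and the remainder lies in degrees `a + 1` to `a + n + 1`.
  have main (n : ℕ) : ∀ (a : ℤ) (X : DerivedCategory C) (hX : B X), X.IsGE a →
      X.IsLE (a + n) → P ⟨X, hX⟩ := by
    induction n with
    | zero =>
      intro a X hX h₁ h₂
      exact single X hX a h₁ (by simpa using h₂)
    | succ n ih =>
      intro a X hX h₁ h₂
      obtain ⟨X', Y, hX', hY, f, g, h, hT⟩ := TStructure.t.exists_triangle X a (a + 1) rfl
      have l₁ : X'.IsLE a := ⟨hX'⟩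
      have l₂ : Y.IsGE (a + 1) := ⟨hY⟩
      have l₃ : X'.IsGE a := by
        rw [isGE_iff]
        intro i hi
        exact (HomologySequence.exact₁ _ hT (i - 1) i).isZero_of_both_zeros
          ((isZero_of_isGE Y (a + 1) (i - 1) (by lia)).eq_of_src _ _)
          ((isZero_of_isGE X a i hi).eq_of_tgt _ _)
      have l₄ : Y.IsLE (a + (n + 1 : ℕ)) := by
        rw [isLE_iff]
        intro i hi
        exact (HomologySequence.exact₃ _ hT i (i + 1)).isZero_of_both_zeros
          ((isZero_of_isLE X _ i hi).eq_of_src _ _)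
          ((isZero_of_isLE X' a (i + 1) (by lia)).eq_of_tgt _ _)
      have hX'B : B X' := ⟨⟨_, l₃⟩, ⟨_, l₁⟩⟩
      have hYB : B Y := ⟨⟨_, l₂⟩, ⟨_, l₄⟩⟩
      obtain ⟨f', g', h', hT'⟩ := exists_distTriang_fullSubcategory B hT hX'B hX hYB
      exact P.ext_of_isTriangulatedClosed₂ _ hT' (single X' hX'B a l₃ l₁)
        (ih (a + 1) Y hYB l₂ (by
          have : a + 1 + (n : ℤ) = a + ((n + 1 : ℕ) : ℤ) := by push_cast; ring
          rwa [this]))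
  obtain ⟨X, ⟨a, ha⟩, ⟨b, hb⟩⟩ := X
  -- If `b < a`, `toNat` gives `0`; in every case `a + (b - a).toNat ≥ b`.
  refine main (b - a).toNat a X _ ha ?_
  exact TStructure.t.isLE_of_le X b _ (by lia)

/-- Degreewise vanishing of the self-extensions, in the bounded derived category. -/
lemma toBounded_hom_shift_eq_zero [HasExt.{w} C] {X Y : C}
    (h : ∀ m : ℕ, 0 < m → Subsingleton (Ext.{w} X Y m)) (i : ℤ) (hi : i ≠ 0)
    (f : toBounded.{w'} X ⟶ (toBounded.{w'} Y)⟦i⟧) : f = 0 := by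
  let B := (TStructure.t (C := C)).bounded
  suffices ∀ g : (singleFunctor C 0).obj X ⟶ ((singleFunctor C 0).obj Y)⟦i⟧, g = 0 by
    apply B.ι.map_injective
    rw [Functor.map_zero, ← cancel_mono ((B.ι.commShiftIso i).hom.app (toBounded.{w'} Y)),
      zero_comp]
    exact this _
  intro g
  rcases lt_or_gt_of_ne hi with hi | hi
  -- For `i < 0` the target lives in positive degrees, so orthogonality of the t-structure applies;
  -- for `i > 0` the morphism is an `Ext` class.
  · have : (((singleFunctor C 0).obj Y)⟦i⟧).IsGE (-i) := TStructure.t.isGE_shift _ 0 i (-i) (by lia)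
    exact TStructure.t.zero g 0 (-i) (by lia)
  · obtain ⟨m, rfl⟩ := Int.eq_ofNat_of_zero_le hi.le
    have := h m (by lia)
    exact (Ext.homEquiv (C := C) (X := X) (Y := Y) (n := m)).symm.injective
      (Subsingleton.elim _ _)

lemma addClosure_toBounded_of_retract {X Y : C} (r : Retract X Y) :
    addClosure (toBounded.{w'} Y) (toBounded.{w'} X) := by
  let B := (TStructure.t (C := C)).bounded
  let φ {X Y : C} (f : X ⟶ Y) : toBounded.{w'} X ⟶ toBounded.{w'} Y :=
    B.homMk ((singleFunctor C 0).map f)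
  have hφ : φ r.i ≫ φ r.r = 𝟙 _ := by
    apply B.ι.map_injective
    change (singleFunctor C 0).map r.i ≫ (singleFunctor C 0).map r.r = 𝟙 _
    rw [← Functor.map_comp, r.retract, CategoryTheory.Functor.map_id]
  exact ⟨1, ⟨{
    i := φ r.i ≫ biproduct.ι (fun _ : Fin 1 => toBounded.{w'} Y) 0
    r := biproduct.π (fun _ : Fin 1 => toBounded.{w'} Y) 0 ≫ φ r.r
    retract := by
      rw [Category.assoc, biproduct.ι_π_self_assoc, hφ] }⟩⟩

end BoundedDerived

end TiltingTheory

/-! ### The tilting theorem. -/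

theorem mainTheorem5 {k : Type*} [Field k] {B : Type u} [Category.{v} B] [Abelian B] [Linear k B]
    [HasExt.{w} B] [HasDerivedCategory.{w'} B]
    (hB : TiltingTheory.IsExtFinite.{w} k B)
    (hKrull : TiltingTheory.HasFiniteKrullDimension B)
    {n : ℕ} (T : Fin n → B)
    (hT : TiltingTheory.IsExceptionalCollection.{w} T)
    (hpd : ∀ i, HasProjectiveDimensionLE (T i) 1)
    (hext : ∀ i j, Subsingleton (Abelian.Ext.{w} (T i) (T j) 1))
    (hrank : Module.rank ℤ (TiltingTheory.K₀ B) = (n : Cardinal)) :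
    TiltingTheory.IsTiltingObject.{w'} (⨁ T) where
  hom_shift_eq_zero i hi f := by
    refine TiltingTheory.toBounded_hom_shift_eq_zero.{w} (fun m hm => ?_) i hi f
    have h (i j : Fin n) : Subsingleton (Abelian.Ext.{w} (T i) (T j) m) := by
      obtain rfl | hm : m = 1 ∨ 2 ≤ m := by omega
      · exact hext i j
      · have := hpd i
        exact subsingleton_of_forall_eq 0 fun x =>
          x.eq_zero_of_hasProjectiveDimensionLT 2 hm
    have h' (i : Fin n) : Subsingleton (Abelian.Ext.{w} (T i) (⨁ T) m) :=
      (Abelian.Ext.addEquivBiproduct (T i) (biproduct.isBilimit T) m).toEquiv.subsingleton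
    exact (Abelian.Ext.biproductAddEquiv (biproduct.isBilimit T) (⨁ T) m).toEquiv.subsingleton
  generates P _ _ hTP X := by
    refine TiltingTheory.prop_of_prop_toBounded P (fun Y => ?_) X
    have hQ₀ : ∀ ⦃Y : B⦄, IsZero Y → P (TiltingTheory.toBounded.{w'} Y) := fun Y hY => by
      refine P.prop_of_isZero ?_
      rw [IsZero.iff_id_eq_zero]
      apply (DerivedCategory.TStructure.t (C := B)).bounded.ι.map_injective
      exact ((DerivedCategory.singleFunctor B 0).map_isZero hY).eq_of_src _ _
    -- Membership in `P` has the two out of three property on short exact sequences, since these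
    -- give triangles; the perpendicular category contributes only zero objects.
    refine hT.prop_of_perp hB hpd (Q := fun Y => P (TiltingTheory.toBounded.{w'} Y)) hQ₀
      (fun S hS h₂ h₃ => ?_) (fun S hS h₁ h₃ => ?_) (fun S hS h₁ h₂ => ?_) (fun i => ?_)
      (fun Z hZ => hQ₀ (hT.isZero_of_perp hB hKrull hpd hext hrank hZ)) Y
    · obtain ⟨f, g, h, hD⟩ := TiltingTheory.exists_distTriang_toBounded.{w'} hS
      exact P.ext_of_isTriangulatedClosed₁ _ hD h₂ h₃
    · obtain ⟨f, g, h, hD⟩ := TiltingTheory.exists_distTriang_toBounded.{w'} hS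
      exact P.ext_of_isTriangulatedClosed₂ _ hD h₁ h₃
    · obtain ⟨f, g, h, hD⟩ := TiltingTheory.exists_distTriang_toBounded.{w'} hS
      exact P.ext_of_isTriangulatedClosed₃ _ hD h₁ h₂
    · exact hTP _ (TiltingTheory.addClosure_toBounded_of_retract
        ⟨biproduct.ι T i, biproduct.π T i, biproduct.ι_π_self T i⟩)
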